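/- Let $n\ge 1$, $m,\tilde m\ge 0$ and consider $x_{k+1}=Ax_k+\omega_k$, $y_k=Cx_k+v_k$, $y^{e}_k=C^{e}x_k+v^{e}_k$ ($k\ge 0$), where $x_k\in\mathbb R^n$, $y_k\in\mathbb R^m$, $y_k^e\in\mathbb R^{\tilde m}$, and $\omega,v,v^{e}$ are mutually uncorrelated zero-mean square-integrable white noises with positive definite covariances $Q,R,R^{e}$ (for instance Gaussian). Assume that $(A,C)$ is detectable. Put $\mathrm{Ric}(A,C,Q,R,P)=APA^{\mathsf T}+Q-APC^{\mathsf T}(CPC^{\mathsf T}+R)^{-1}CPA^{\mathsf T}$, $\bar C=\begin{bmatrix}C\\ C^{e}\end{bmatrix}$, $\bar R=\mathrm{diag}(R,R^{e})$, $y^{c}_k=\begin{bmatrix}y_k\\ y^{e}_k\end{bmatrix}$. The equations $\bar P=\mathrm{Ric}(A,\bar C,Q,\bar R,\bar P)$ and $P=\mathrm{Ric}(A,C,Q,R,P)$ have unique positive semidefinite solutions $\bar P$ and $P$. Let $\bar L=A\bar P\bar C^{\mathsf T}(\bar C\bar P\bar C^{\mathsf T}+\bar R)^{-1}$, $P^{(1)}=\bar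 P$, $P^{(l+1)}=\mathrm{Ric}(A,C,Q,R,P^{(l)})$, $L^{(l)}=AP^{(l)}C^{\mathsf T}(CP^{(l)}C^{\mathsf T}+R)^{-1}$, and, for a delay $d\ge 0$ and $0\le l\le d$, $\Phi_{d-l}=(A-L^{(d)}C)\cdots(A-L^{(l+1)}C)$ (with $d$ fixed; the empty product is $I$). Let $\bar x_{k+1}=A\bar x_k+\bar L(y^{c}_k-\bar C\bar x_k)$ be the centralized Kalman predictor in steady state, i.e. $x_0-\bar x_0$ has mean zero and covariance $\bar P$ and is uncorrelated with all the noises. For $k\ge d$ let $\hat x_k=\Phi_d\bar x_{k-d}+\sum_{l=1}^{d}\Phi_{d-l}L^{(l)}y_{k-1-d+l}$ be the steady-state predictor based on local observations and on external observations delayed by $d$, and let $r_k=y_k-C\hat x_k$ be the innovation. Thus, for every $p\ge0$ and $k\ge d+p$, the autoregressive model $$y_k=\sum_{l=1}^{d}C\Phi_{d-l}L^{(l)}y_{k-1-d+l}+\sum_{j=0}^{p-1}C\Phi_d(A-\bar L\bar C)^{j}\bar L\,y^{c}_{k-d-1-j}+C\Phi_d(A-\bar L\bar C)^p\bar x_{k-d-p}+r_k$$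 holds. Then: 1. For all $k,l\ge d$, $r_k$ is square-integrable with mean zero, $\mathbb E[r_kr_l^{\mathsf T}]=0$ if $k\ne l$, and $\mathbb E[r_kr_k^{\mathsf T}]=CP^{(d+1)}C^{\mathsf T}+R$. 2. The covariance $\mathbb E[r_kr_k^{\mathsf T}]=CP^{(d+1)}C^{\mathsf T}+R$ equals $C\bar PC^{\mathsf T}+R$ for $d=0$ and converges exponentially to $CPC^{\mathsf T}+R$ as $d\to\infty$: there are $M$ and $\gamma\in(0,1)$, depending only on the system matrices and noise covariances, with $\|CP^{(d+1)}C^{\mathsf T}+R-(CPC^{\mathsf T}+R)\|_2\le M\gamma^d$ for all $d\ge 0$. 3. $\Phi_d$ is exponentially stable: for every $d\ge0$, $\|\Phi_d\|_2^2\le\tau\rho_0^{d}$ with $\tau=\dfrac{\lambda_{\max}(P^{(d+1)})}{\lambda_{\min}(P^{(1)})}$ and $\rho_0=1-\dfrac{\lambda_{\min}(Q)}{\lambda_{\max}(P^{(d+1)})}\in[0,1)$, where $\rho_0>0$ unless $A=0$ and $Q$ is a multiple of the identity (and $0^0=1$); moreover there are $M$ and $\gamma\in(0,1)$, independent of $d$,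 with $\|\Phi_d\|_2^2\le M\gamma^d$ for all $d\ge 0$. -/

import Mathlib

open scoped Matrix
open MeasureTheory

noncomputable section

/-- The Riccati operator
`Ric(A,C,Q,R,P) = A P Aᵀ + Q - A P Cᵀ (C P Cᵀ + R)⁻¹ C P Aᵀ`. -/
def riccati {ι κ : Type*} [Fintype ι] [Fintype κ] [DecidableEq κ]
    (A : Matrix ι ι ℝ) (C : Matrix κ ι ℝ) (Q : Matrix ι ι ℝ) (R : Matrix κ κ ℝ)
    (P : Matrix ι ι ℝ) : Matrix ι ι ℝ :=
  A * P * Aᵀ + Q - A * P * Cᵀ * (C * P * Cᵀ + R)⁻¹ * C * P * Aᵀ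

/-- The Kalman (prediction) gain `A P Cᵀ (C P Cᵀ + R)⁻¹`. -/
def kalmanGain {ι κ : Type*} [Fintype ι] [Fintype κ] [DecidableEq κ]
    (A : Matrix ι ι ℝ) (C : Matrix κ ι ℝ) (R : Matrix κ κ ℝ) (P : Matrix ι ι ℝ) :
    Matrix ι κ ℝ :=
  A * P * Cᵀ * (C * P * Cᵀ + R)⁻¹

/-- `P` is a positive semidefinite solution of the algebraic Riccati equation
`P = Ric(A,C,Q,R,P)`. -/
def IsRiccatiSolution {ι κ : Type*} [Fintype ι] [Fintype κ] [DecidableEq κ]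
    (A : Matrix ι ι ℝ) (C : Matrix κ ι ℝ) (Q : Matrix ι ι ℝ) (R : Matrix κ κ ℝ)
    (P : Matrix ι ι ℝ) : Prop :=
  P.PosSemidef ∧ P = riccati A C Q R P

/-- A real square matrix is Schur stable if all its complex eigenvalues lie in the open unit
disc. -/
def SchurStable {ι : Type*} [Fintype ι] [DecidableEq ι] (M : Matrix ι ι ℝ) : Prop :=
  ∀ z ∈ spectrum ℂ (M.map (algebraMap ℝ ℂ)), ‖z‖ < 1

/-- `(A, C)` is detectable: some output injection `K` makes `A - K C` Schur stable. -/
def Detectable {ι κ : Type*} [Fintype ι] [DecidableEq ι] [Fintype κ]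
    (A : Matrix ι ι ℝ) (C : Matrix κ ι ℝ) : Prop :=
  ∃ K : Matrix ι κ ℝ, SchurStable (A - K * C)

/-- Largest eigenvalue (used for symmetric matrices of positive size). -/
def lamMax {ι : Type*} [Fintype ι] [DecidableEq ι] (M : Matrix ι ι ℝ) : ℝ :=
  sSup (spectrum ℝ M)

/-- Smallest eigenvalue (used for symmetric matrices of positive size). -/
def lamMin {ι : Type*} [Fintype ι] [DecidableEq ι] (M : Matrix ι ι ℝ) : ℝ :=
  sInf (spectrum ℝ M)

/-- Spectral norm: the operator norm for the Euclidean norm. -/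
def specNorm {ι : Type*} [Fintype ι] [DecidableEq ι] (M : Matrix ι ι ℝ) : ℝ :=
  ‖Matrix.toEuclideanCLM (n := ι) (𝕜 := ℝ) M‖

/-- The matrix `E[X Yᵀ]` of two random vectors. -/
def crossMoment {Ω ι κ : Type*} [MeasurableSpace Ω] (μ : Measure Ω)
    (X : Ω → ι → ℝ) (Y : Ω → κ → ℝ) : Matrix ι κ ℝ :=
  Matrix.of fun i j => ∫ ω, X ω i * Y ω j ∂μ

/-- A zero-mean, square-integrable random vector. -/
structure IsCenteredL2 {Ω ι : Type*} [MeasurableSpace Ω] (μ : Measure Ω)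
    (X : Ω → ι → ℝ) : Prop where
  memLp : ∀ i, MemLp (fun ω => X ω i) 2 μ
  mean : ∀ i, ∫ ω, X ω i ∂μ = 0

/-- White noise with covariance `S`: centered, square-integrable, uncorrelated in time, with
`E[w_k w_kᵀ] = S`. -/
structure IsWhiteNoise {Ω ι : Type*} [MeasurableSpace Ω] (μ : Measure Ω)
    (S : Matrix ι ι ℝ) (w : ℕ → Ω → ι → ℝ) : Prop where
  centered : ∀ k, IsCenteredL2 μ (w k)
  cov : ∀ k l, crossMoment μ (w k) (w l) = if k = l then S else 0

/-- Parameters of the system `x_{k+1} = A x_k + w_k`, `y_k = C x_k + v_k` with external source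
`y^e_k = C^e x_k + v^e_k`; `Q`, `R`, `Re` are the covariances of `w`, `v`, `v^e`. -/
structure TwoSourceModel (n m m' : ℕ) where
  A : Matrix (Fin n) (Fin n) ℝ
  C : Matrix (Fin m) (Fin n) ℝ
  Ce : Matrix (Fin m') (Fin n) ℝ
  Q : Matrix (Fin n) (Fin n) ℝ
  R : Matrix (Fin m) (Fin m) ℝ
  Re : Matrix (Fin m') (Fin m') ℝ

namespace TwoSourceModel

variable {n m m' : ℕ} (S : TwoSourceModel n m m')

/-- The centralized observation matrix `[C; C^e]`. -/
def Cbar : Matrix (Fin m ⊕ Fin m') (Fin n) ℝ := Matrix.fromRows S.C S.Ce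

/-- The centralized observation noise covariance `diag(R, R^e)`. -/
def Rbar : Matrix (Fin m ⊕ Fin m') (Fin m ⊕ Fin m') ℝ := Matrix.fromBlocks S.R 0 0 S.Re

/-- The centralized gain `A P̄ C̄ᵀ (C̄ P̄ C̄ᵀ + R̄)⁻¹`. -/
def Lbar (Pbar : Matrix (Fin n) (Fin n) ℝ) : Matrix (Fin n) (Fin m ⊕ Fin m') ℝ :=
  kalmanGain S.A S.Cbar S.Rbar Pbar

/-- `S.cov Pbar j` is `P^{(j+1)}`: `j` steps of the local Riccati recursion started from
`P^{(1)} = P̄`. -/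
def cov (Pbar : Matrix (Fin n) (Fin n) ℝ) (j : ℕ) : Matrix (Fin n) (Fin n) ℝ :=
  (riccati S.A S.C S.Q S.R)^[j] Pbar

/-- `S.gain Pbar j` is `L^{(j+1)} = A P^{(j+1)} Cᵀ (C P^{(j+1)} Cᵀ + R)⁻¹`. -/
def gain (Pbar : Matrix (Fin n) (Fin n) ℝ) (j : ℕ) : Matrix (Fin n) (Fin m) ℝ :=
  kalmanGain S.A S.C S.R (S.cov Pbar j)

/-- `S.transition Pbar l t` is the ordered product
`(A - L^{(l+t)} C) ⋯ (A - L^{(l+2)} C) (A - L^{(l+1)} C)` of `t` factors. -/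
def transition (Pbar : Matrix (Fin n) (Fin n) ℝ) (l : ℕ) : ℕ → Matrix (Fin n) (Fin n) ℝ
  | 0 => 1
  | t + 1 => (S.A - S.gain Pbar (l + t) * S.C) * transition Pbar l t

/-- The state-transition matrix `Φ_d = (A - L^{(d)} C) ⋯ (A - L^{(1)} C)`. -/
def Phi (Pbar : Matrix (Fin n) (Fin n) ℝ) (d : ℕ) : Matrix (Fin n) (Fin n) ℝ :=
  S.transition Pbar 0 d

/-- `C P^{(d+1)} Cᵀ + R`. -/
def innovationCov (Pbar : Matrix (Fin n) (Fin n) ℝ) (d : ℕ) : Matrix (Fin m) (Fin m) ℝ :=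
  S.C * S.cov Pbar d * S.Cᵀ + S.R

end TwoSourceModel

/-- The two-source system driven by mutually uncorrelated white noises, together with its
steady-state centralized Kalman predictor `x̄`. Steady state means that the constant gain `L̄` is
used and that the initial error `x_0 - x̄_0` is centered, has covariance `P̄`, and is uncorrelated
with the noises (for instance `x_0` has covariance `P̄` and `x̄_0 = E x_0`). -/
structure SteadyRun {n m m' : ℕ} (S : TwoSourceModel n m m') (Pbar : Matrix (Fin n) (Fin n) ℝ)
    {Ω : Type*} [MeasurableSpace Ω] (μ : Measure Ω) where
  /-- state -/
  x : ℕ → Ω → Fin n → ℝ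
  /-- process noise -/
  w : ℕ → Ω → Fin n → ℝ
  /-- local observation noise -/
  v : ℕ → Ω → Fin m → ℝ
  /-- external observation noise -/
  ve : ℕ → Ω → Fin m' → ℝ
  /-- centralized steady-state predictor -/
  xbar : ℕ → Ω → Fin n → ℝ
  noise_w : IsWhiteNoise μ S.Q w
  noise_v : IsWhiteNoise μ S.R v
  noise_ve : IsWhiteNoise μ S.Re ve
  uncorr_w_v : ∀ k l, crossMoment μ (w k) (v l) = 0
  uncorr_w_ve : ∀ k l, crossMoment μ (w k) (ve l) = 0
  uncorr_v_ve : ∀ k l, crossMoment μ (v k) (ve l) = 0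
  state_eq : ∀ k ω, x (k + 1) ω = S.A *ᵥ x k ω + w k ω
  filter_eq : ∀ k ω, xbar (k + 1) ω = S.A *ᵥ xbar k ω +
    S.Lbar Pbar *ᵥ
      (Sum.elim (S.C *ᵥ x k ω + v k ω) (S.Ce *ᵥ x k ω + ve k ω) - S.Cbar *ᵥ xbar k ω)
  init_centered : IsCenteredL2 μ (fun ω => x 0 ω - xbar 0 ω)
  init_cov : crossMoment μ (fun ω => x 0 ω - xbar 0 ω) (fun ω => x 0 ω - xbar 0 ω) = Pbar
  init_w : ∀ k, crossMoment μ (fun ω => x 0 ω - xbar 0 ω) (w k) = 0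
  init_v : ∀ k, crossMoment μ (fun ω => x 0 ω - xbar 0 ω) (v k) = 0
  init_ve : ∀ k, crossMoment μ (fun ω => x 0 ω - xbar 0 ω) (ve k) = 0

namespace SteadyRun

variable {n m m' : ℕ} {S : TwoSourceModel n m m'} {Pbar : Matrix (Fin n) (Fin n) ℝ}
  {Ω : Type*} [MeasurableSpace Ω] {μ : Measure Ω} (T : SteadyRun S Pbar μ)

/-- Local observation `y_k = C x_k + v_k`. -/
def y (k : ℕ) (ω : Ω) : Fin m → ℝ := S.C *ᵥ T.x k ω + T.v k ω

/-- External observation `y^e_k = C^e x_k + v^e_k`. -/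
def ye (k : ℕ) (ω : Ω) : Fin m' → ℝ := S.Ce *ᵥ T.x k ω + T.ve k ω

/-- Centralized observation `y^c_k`: the local and the external one stacked. -/
def yc (k : ℕ) (ω : Ω) : Fin m ⊕ Fin m' → ℝ := Sum.elim (T.y k ω) (T.ye k ω)

/-- The steady-state predictor of `x_k` (for `k ≥ d`) from `y_0, …, y_{k-1}` and the delayed
`y^e_0, …, y^e_{k-1-d}`:
`x̂_k = Φ_d x̄_{k-d} + ∑_{l=1}^{d} (A - L^{(d)} C) ⋯ (A - L^{(l+1)} C) L^{(l)} y_{k-1-d+l}`,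
where the sum is indexed by `i = l - 1`. -/
def xhat (d k : ℕ) (ω : Ω) : Fin n → ℝ :=
  S.Phi Pbar d *ᵥ T.xbar (k - d) ω +
    ∑ i ∈ Finset.range d,
      (S.transition Pbar (i + 1) (d - (i + 1)) * S.gain Pbar i) *ᵥ T.y (k - d + i) ω

/-- The innovation `r_k = y_k - C x̂_k` (for `k ≥ d`). -/
def innovation (d k : ℕ) (ω : Ω) : Fin m → ℝ := T.y k ω - S.C *ᵥ T.xhat d k ω

end SteadyRun

end

/-! For a fixed gain the Joseph update is an affine, order-preserving function of the covariance.
Completing the square shows that the Riccati map is the minimum of these updates over all gains,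
attained at the Kalman gain (`josephUpdate_eq`). This gives monotonicity, a comparison of Ric P -
Ric P' through conjugation by the closed loop at P' (`riccati_sub_le`), and F P Fᵀ + Q ≤ Ric P for
the closed loop F at P. As Q is positive definite, the last inequality makes F contract in the
metric of the covariances: F P Fᵀ ≤ ρ Ric P with ρ = 1 - λ_min(Q)/b whenever Ric P ≤ b·1.

Iterating that contraction (`Matrix.le_smul_geometric_of_conj_le`) yields uniqueness of the Riccati
solutions, P̄ ≤ P, the geometric convergence of P^(l) to P and the decay of Φ_d. Existence uses
detectability: the Lyapunov solution for a stabilizing output injection bounds the increasing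
Riccati iterates started from 0, and their limit is a fixed point.

A local gain padded by zeros is a suboptimal centralized gain, so P̄ ≤ Ric(A,C,Q,R,P̄). Hence P^(l)
increases and stays below P; in particular P^(d+1) bounds all earlier covariances, which is why the
explicit rate involves only its largest eigenvalue.

For whiteness, r_k is the local part of the residual of an observer on the stacked observations that
uses L̄ before time s = k - d and padded local Kalman gains from s on. Different k belong to
different observers, so their joint covariances are needed. The orthogonality relation (A - K C) G
Cᵀ = K R of the later-switching observer holds in all directions used by the gain of the
earlier-switching one. Therefore the cross covariance of two errors is the covariance of the
later-switching one, and its error is uncorrelated with the past local residuals of the other. -/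

set_option linter.unusedSectionVars false

/-! ### The Riccati map in the Loewner order. -/

section RiccatiAlgebra

open scoped MatrixOrder
open Matrix

variable {ι κ : Type*} [Fintype ι] [Fintype κ]

theorem Matrix.conj_le_conj {X Y : Matrix ι ι ℝ} (h : X ≤ Y) (F : Matrix κ ι ℝ) :
    F * X * Fᵀ ≤ F * Y * Fᵀ := by
  rw [Matrix.le_iff] at h ⊢
  have := h.mul_mul_conjTranspose_same F
  rwa [conjTranspose_eq_transpose_of_trivial, Matrix.mul_sub, Matrix.sub_mul] at this

theorem Matrix.conj_nonneg {X : Matrix ι ι ℝ} (h : 0 ≤ X) (F : Matrix κ ι ℝ) :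
    0 ≤ F * X * Fᵀ := by
  simpa using conj_le_conj h F

theorem Matrix.transpose_eq_of_nonneg {X : Matrix ι ι ℝ} (h : 0 ≤ X) : Xᵀ = X := by
  simpa using h.posSemidef.isHermitian.eq

theorem Matrix.quadratic_le {X Y : Matrix ι ι ℝ} (h : X ≤ Y) (x : ι → ℝ) :
    x ⬝ᵥ (X *ᵥ x) ≤ x ⬝ᵥ (Y *ᵥ x) := by
  have := (Matrix.le_iff.1 h).dotProduct_mulVec_nonneg x
  simpa [Matrix.sub_mulVec, dotProduct_sub] using this

theorem Matrix.nonneg_of_quadratic {X : Matrix ι ι ℝ} (hX : Xᵀ = X)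
    (h : ∀ x, 0 ≤ x ⬝ᵥ (X *ᵥ x)) : 0 ≤ X := by
  rw [Matrix.nonneg_iff_posSemidef]
  exact .of_dotProduct_mulVec_nonneg (by simpa [Matrix.IsHermitian] using hX) (by simpa using h)

theorem Matrix.posDef_of_le {X Y : Matrix ι ι ℝ} (hX : X.PosDef) (h : X ≤ Y) : Y.PosDef := by
  simpa using hX.add_posSemidef (Matrix.le_iff.1 h)

theorem Matrix.smul_le_smul_matrix {X Y : Matrix ι ι ℝ} (h : X ≤ Y) {c : ℝ} (hc : 0 ≤ c) :
    c • X ≤ c • Y := by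
  rw [Matrix.le_iff] at h ⊢
  simpa [smul_sub] using h.smul hc

theorem Matrix.smul_le_smul_of_scalar_le {X : Matrix ι ι ℝ} (h : 0 ≤ X) {b c : ℝ} (hc : b ≤ c) :
    b • X ≤ c • X := by
  rw [Matrix.le_iff]
  simpa [sub_smul] using h.posSemidef.smul (sub_nonneg.2 hc)

/-- The common engine of all geometric estimates below: conjugation preserves the order, so the
contraction of `P` along `F` passes to anything initially dominated by it. `D` need not be
nonnegative, so differences of covariances are allowed. -/
theorem Matrix.le_smul_geometric_of_conj_le {D P F : ℕ → Matrix ι ι ℝ} {c ρ : ℝ}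
    (hc : 0 ≤ c) (hρ : 0 ≤ ρ) (h0 : D 0 ≤ c • P 0)
    (k : ℕ) (hD : ∀ j < k, D (j + 1) ≤ F j * D j * (F j)ᵀ)
    (hP : ∀ j < k, F j * P j * (F j)ᵀ ≤ ρ • P (j + 1)) :
    D k ≤ (c * ρ ^ k) • P k := by
  induction k with
  | zero => simpa using h0
  | succ k ih =>
    have ih := ih (fun j hj => hD j (by omega)) (fun j hj => hP j (by omega))
    calc D (k + 1) ≤ F k * D k * (F k)ᵀ := hD k (by omega)
      _ ≤ F k * ((c * ρ ^ k) • P k) * (F k)ᵀ := conj_le_conj ih _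
      _ = (c * ρ ^ k) • (F k * P k * (F k)ᵀ) := by simp
      _ ≤ (c * ρ ^ k) • (ρ • P (k + 1)) := smul_le_smul_matrix (hP k (by omega)) (by positivity)
      _ = (c * ρ ^ (k + 1)) • P (k + 1) := by rw [smul_smul, pow_succ, mul_assoc]

variable [DecidableEq κ]

/-- The covariance update of a linear observer with an arbitrary gain `K` (Joseph form). -/
def josephUpdate (A : Matrix ι ι ℝ) (C : Matrix κ ι ℝ) (Q : Matrix ι ι ℝ) (R : Matrix κ κ ℝ)
    (K : Matrix ι κ ℝ) (P : Matrix ι ι ℝ) : Matrix ι ι ℝ :=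
  (A - K * C) * P * (A - K * C)ᵀ + Q + K * R * Kᵀ

variable {A : Matrix ι ι ℝ} {C : Matrix κ ι ℝ} {Q : Matrix ι ι ℝ} {R : Matrix κ κ ℝ}

theorem innovation_posDef (hR : R.PosDef) {P : Matrix ι ι ℝ} (hP : 0 ≤ P) :
    (C * P * Cᵀ + R).PosDef :=
  hR.posSemidef_add (conj_nonneg hP C).posSemidef

theorem kalmanGain_mul_innovation (hR : R.PosDef) {P : Matrix ι ι ℝ} (hP : 0 ≤ P) :
    kalmanGain A C R P * (C * P * Cᵀ + R) = A * P * Cᵀ := by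
  have := (isUnit_iff_isUnit_det _).1 (innovation_posDef (C := C) hR hP).isUnit
  rw [kalmanGain, Matrix.mul_assoc, Matrix.nonsing_inv_mul _ this, Matrix.mul_one]

/-- The orthogonality relation that characterizes the Kalman gain. -/
theorem kalmanGain_orthogonality (hR : R.PosDef) {P : Matrix ι ι ℝ} (hP : 0 ≤ P) :
    (A - kalmanGain A C R P * C) * P * Cᵀ = kalmanGain A C R P * R := by
  have h := kalmanGain_mul_innovation (A := A) (C := C) hR hP
  rw [Matrix.mul_add] at h
  rw [Matrix.sub_mul, Matrix.sub_mul, ← h]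
  simp only [Matrix.mul_assoc]
  abel

theorem riccati_eq_sub (P : Matrix ι ι ℝ) :
    riccati A C Q R P = A * P * Aᵀ + Q - kalmanGain A C R P * (C * P * Aᵀ) := by
  simp only [riccati, kalmanGain, Matrix.mul_assoc]

/-- Completion of the square in `K`; the cross terms are rewritten with the normal equation L (C P
Cᵀ + R) = A P Cᵀ of the Kalman gain L. -/
theorem josephUpdate_eq (hR : R.PosDef) {P : Matrix ι ι ℝ} (hP : 0 ≤ P) (K : Matrix ι κ ℝ) :
    josephUpdate A C Q R K P = riccati A C Q R P +
      (K - kalmanGain A C R P) * (C * P * Cᵀ + R) * (K - kalmanGain A C R P)ᵀ := by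
  have h := kalmanGain_mul_innovation (A := A) (C := C) hR hP
  have hS := transpose_eq_of_nonneg (innovation_posDef (C := C) hR hP).posSemidef.nonneg
  have hPt := transpose_eq_of_nonneg hP
  rw [riccati_eq_sub]
  set L := kalmanGain A C R P
  have h' : (C * P * Cᵀ + R) * Lᵀ = C * P * Aᵀ := by
    have := congrArg transpose h
    rwa [transpose_mul, hS, transpose_mul, transpose_mul, transpose_transpose, hPt,
      ← Matrix.mul_assoc] at this
  have e : (K - L) * (C * P * Cᵀ + R) * (K - L)ᵀ
      = K * (C * P * Cᵀ + R) * Kᵀ - K * (C * P * Aᵀ) - A * P * Cᵀ * Kᵀ + L * (C * P * Aᵀ) := by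
    rw [Matrix.sub_mul, h, transpose_sub, Matrix.mul_sub, Matrix.sub_mul, Matrix.sub_mul,
      ← h', ← h]
    simp only [Matrix.mul_assoc]
    abel
  rw [e, josephUpdate]
  simp only [transpose_sub, transpose_mul, Matrix.mul_sub, Matrix.sub_mul, Matrix.mul_add,
    Matrix.add_mul, Matrix.mul_assoc]
  abel

theorem josephUpdate_kalmanGain (hR : R.PosDef) {P : Matrix ι ι ℝ} (hP : 0 ≤ P) :
    josephUpdate A C Q R (kalmanGain A C R P) P = riccati A C Q R P := by
  simp [josephUpdate_eq hR hP]

theorem riccati_le_josephUpdate (hR : R.PosDef) {P : Matrix ι ι ℝ} (hP : 0 ≤ P)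
    (K : Matrix ι κ ℝ) : riccati A C Q R P ≤ josephUpdate A C Q R K P := by
  rw [josephUpdate_eq hR hP]
  exact le_add_of_nonneg_right (conj_nonneg (innovation_posDef hR hP).posSemidef.nonneg _)

theorem josephUpdate_mono {P P' : Matrix ι ι ℝ} (h : P ≤ P') (K : Matrix ι κ ℝ) :
    josephUpdate A C Q R K P ≤ josephUpdate A C Q R K P' := by
  unfold josephUpdate
  gcongr
  exact conj_le_conj h _

theorem josephUpdate_sub (P P' : Matrix ι ι ℝ) (K : Matrix ι κ ℝ) :
    josephUpdate A C Q R K P - josephUpdate A C Q R K P'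
      = (A - K * C) * (P - P') * (A - K * C)ᵀ := by
  rw [Matrix.mul_sub, Matrix.sub_mul, josephUpdate, josephUpdate]
  abel

/-- The gain optimal for `P'` is suboptimal for `P`, and with the gain fixed the update is monotone.
-/
theorem riccati_mono (hR : R.PosDef) {P P' : Matrix ι ι ℝ} (hP : 0 ≤ P) (h : P ≤ P') :
    riccati A C Q R P ≤ riccati A C Q R P' := by
  rw [← josephUpdate_kalmanGain hR (hP.trans h)]
  exact (riccati_le_josephUpdate hR hP _).trans (josephUpdate_mono h _)

/-- With the gain of `P'` used for both, the update is exact at `P'` and only an upper bound at `P`;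
`Q` and the noise term cancel. -/
theorem riccati_sub_le (hR : R.PosDef) {P P' : Matrix ι ι ℝ} (hP : 0 ≤ P) (hP' : 0 ≤ P') :
    riccati A C Q R P - riccati A C Q R P' ≤
      (A - kalmanGain A C R P' * C) * (P - P') * (A - kalmanGain A C R P' * C)ᵀ := by
  rw [← josephUpdate_sub (Q := Q) (R := R), josephUpdate_kalmanGain hR hP']
  exact sub_le_sub_right (riccati_le_josephUpdate hR hP _) _

theorem closedLoop_conj_add_le_riccati (hR : R.PosDef) {P : Matrix ι ι ℝ} (hP : 0 ≤ P) :
    (A - kalmanGain A C R P * C) * P * (A - kalmanGain A C R P * C)ᵀ + Q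
      ≤ riccati A C Q R P := by
  rw [← josephUpdate_kalmanGain hR hP, josephUpdate]
  exact le_add_of_nonneg_right (conj_nonneg hR.posSemidef.nonneg _)

theorem le_riccati (hR : R.PosDef) {P : Matrix ι ι ℝ} (hP : 0 ≤ P) : Q ≤ riccati A C Q R P :=
  le_trans (le_add_of_nonneg_left (conj_nonneg hP _)) (closedLoop_conj_add_le_riccati hR hP)

variable [DecidableEq ι]

/-- One step of the closed-loop error dynamics contracts in the metric of the covariance. -/
theorem closedLoop_conj_le_smul (hR : R.PosDef) {P : Matrix ι ι ℝ} (hP : 0 ≤ P) {a b : ℝ}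
    (ha : 0 ≤ a) (hb : 0 < b) (hQ : a • 1 ≤ Q) (hRic : riccati A C Q R P ≤ b • 1) :
    (A - kalmanGain A C R P * C) * P * (A - kalmanGain A C R P * C)ᵀ
      ≤ (1 - a / b) • riccati A C Q R P := by
  -- The process noise makes up at least the fraction a / b of the updated covariance; removing it
  -- leaves the factor 1 - a / b.
  have h1 : (a / b) • riccati A C Q R P ≤ Q :=
    calc (a / b) • riccati A C Q R P ≤ (a / b) • (b • 1) :=
          smul_le_smul_matrix hRic (by positivity)
      _ = a • 1 := by rw [smul_smul, div_mul_cancel₀ _ hb.ne']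
      _ ≤ Q := hQ
  rw [sub_smul, one_smul]
  exact (le_sub_iff_add_le.2 (closedLoop_conj_add_le_riccati hR hP)).trans (sub_le_sub_left h1 _)

end RiccatiAlgebra

/-! ### Extreme eigenvalues as bounds in the Loewner order. -/

section Eigenvalues

open scoped MatrixOrder
open Matrix

variable {ι : Type*} [Fintype ι] [DecidableEq ι]

theorem Matrix.le_smul_one_iff_spectrum {M : Matrix ι ι ℝ} (hM : M.IsHermitian) {b : ℝ} :
    M ≤ b • 1 ↔ ∀ z ∈ spectrum ℝ M, z ≤ b := by
  rw [← Algebra.algebraMap_eq_smul_one]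
  exact le_algebraMap_iff_spectrum_le hM

theorem Matrix.smul_one_le_iff_spectrum {M : Matrix ι ι ℝ} (hM : M.IsHermitian) {a : ℝ} :
    a • 1 ≤ M ↔ ∀ z ∈ spectrum ℝ M, a ≤ z := by
  rw [← Algebra.algebraMap_eq_smul_one]
  exact algebraMap_le_iff_le_spectrum hM

theorem Matrix.IsHermitian.finite_spectrum {M : Matrix ι ι ℝ} (hM : M.IsHermitian) :
    (spectrum ℝ M).Finite := by
  rw [hM.spectrum_real_eq_range_eigenvalues]
  exact Set.finite_range _

theorem le_lamMax_smul_one {M : Matrix ι ι ℝ} (hM : M.IsHermitian) : M ≤ lamMax M • 1 :=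
  (le_smul_one_iff_spectrum hM).2 fun _ hz => le_csSup hM.finite_spectrum.bddAbove hz

theorem lamMin_smul_one_le {M : Matrix ι ι ℝ} (hM : M.IsHermitian) : lamMin M • 1 ≤ M :=
  (smul_one_le_iff_spectrum hM).2 fun _ hz => csInf_le hM.finite_spectrum.bddBelow hz

variable [Nonempty ι]

theorem Matrix.IsHermitian.spectrum_nonempty {M : Matrix ι ι ℝ} (hM : M.IsHermitian) :
    (spectrum ℝ M).Nonempty := by
  rw [hM.spectrum_real_eq_range_eigenvalues]
  exact Set.range_nonempty _

theorem lamMin_pos {M : Matrix ι ι ℝ} (hM : M.PosDef) : 0 < lamMin M := by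
  have h : lamMin M ∈ spectrum ℝ M :=
    hM.isHermitian.spectrum_nonempty.csInf_mem hM.isHermitian.finite_spectrum
  rw [hM.isHermitian.spectrum_real_eq_range_eigenvalues] at h
  obtain ⟨i, hi⟩ := h
  exact hi ▸ hM.eigenvalues_pos i

theorem Matrix.scalar_le_of_smul_one_le {a b : ℝ} (h : a • (1 : Matrix ι ι ℝ) ≤ b • 1) :
    a ≤ b := by
  obtain ⟨i⟩ := ‹Nonempty ι›
  simpa using (Matrix.le_iff.1 h).diag_nonneg (i := i)

theorem lamMin_le_lamMax_of_le {M N : Matrix ι ι ℝ} (hM : M.IsHermitian) (hN : N.IsHermitian)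
    (h : M ≤ N) : lamMin M ≤ lamMax N :=
  scalar_le_of_smul_one_le ((lamMin_smul_one_le hM).trans (h.trans (le_lamMax_smul_one hN)))

theorem exists_le_smul_of_posDef {D P : Matrix ι ι ℝ} (hD : D.IsHermitian) (hP : P.PosDef) :
    ∃ c : ℝ, 0 ≤ c ∧ D ≤ c • P := by
  have hp := lamMin_pos hP
  -- `D` may be indefinite or negative; the absolute value keeps the constant nonnegative.
  refine ⟨|lamMax D| / lamMin P, by positivity, ?_⟩
  calc D ≤ lamMax D • 1 := le_lamMax_smul_one hD
    _ ≤ |lamMax D| • 1 := smul_le_smul_of_scalar_le PosSemidef.one.nonneg (le_abs_self _)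
    _ = (|lamMax D| / lamMin P) • (lamMin P • 1) := by
      rw [smul_smul, div_mul_cancel₀ _ hp.ne']
    _ ≤ _ := smul_le_smul_matrix (lamMin_smul_one_le hP.isHermitian) (by positivity)

theorem Matrix.nonpos_of_le_geometric {D P : Matrix ι ι ℝ} (hD : D.IsHermitian) {c ρ : ℝ}
    (hρ : 0 ≤ ρ) (hρ1 : ρ < 1) (h : ∀ k : ℕ, D ≤ (c * ρ ^ k) • P) : D ≤ 0 := by
  rw [← neg_nonneg]
  refine nonneg_of_quadratic (by simpa [Matrix.IsHermitian] using hD) fun x => ?_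
  have h1 : ∀ k : ℕ, x ⬝ᵥ (D *ᵥ x) ≤ ρ ^ k * (c * (x ⬝ᵥ (P *ᵥ x))) := fun k => by
    have := quadratic_le (h k) x
    rw [smul_mulVec, dotProduct_smul, smul_eq_mul] at this
    linarith
  have h2 := ((tendsto_pow_atTop_nhds_zero_of_lt_one hρ hρ1).mul_const
    (c * (x ⬝ᵥ (P *ᵥ x))))
  rw [zero_mul] at h2
  have := ge_of_tendsto' h2 h1
  rw [neg_mulVec, dotProduct_neg]
  linarith

end Eigenvalues

/-! ### Schur stability, the Lyapunov equation, and existence and uniqueness of Riccati solutions.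
-/

section Stability

open scoped MatrixOrder Topology
open Matrix Filter

variable {ι κ : Type*} [Fintype ι] [Fintype κ] [DecidableEq ι] [DecidableEq κ]

section Frobenius

open scoped Matrix.Norms.Frobenius ENNReal NNReal

/-- Gelfand's formula over ℂ, with q strictly between the spectral radius and 1. The Frobenius norm
is submultiplicative and is unchanged by the passage from real to complex entries and by
transposition. -/
theorem SchurStable.exists_norm_pow_le [Nonempty ι] {F : Matrix ι ι ℝ} (hF : SchurStable F) :
    ∃ q : ℝ, 0 ≤ q ∧ q < 1 ∧ ∀ᶠ k in atTop, ‖F ^ k‖ ≤ q ^ k := by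
  set M : Matrix ι ι ℂ := F.map (algebraMap ℝ ℂ) with hM
  have hr : spectralRadius ℂ M < (1 : ℝ≥0) :=
    spectrum.spectralRadius_lt_of_forall_lt M fun z hz => by
      simpa [← NNReal.coe_lt_coe] using hF z hz
  obtain ⟨q, hq, hq1⟩ := ENNReal.lt_iff_exists_nnreal_btwn.1 hr
  refine ⟨q, q.2, by exact_mod_cast hq1, ?_⟩
  have ht := spectrum.pow_nnnorm_pow_one_div_tendsto_nhds_spectralRadius M
  filter_upwards [ht.eventually_lt_const hq, eventually_gt_atTop 0] with k hk hk0
  have hpow : ‖F ^ k‖₊ = ‖M ^ k‖₊ := by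
    have : M ^ k = (F ^ k).map (algebraMap ℝ ℂ) := by
      rw [hM]
      exact ((algebraMap ℝ ℂ).mapMatrix.map_pow F k).symm
    rw [this, frobenius_nnnorm_map_eq _ _ fun a => by simp]
  have h1 : (‖M ^ k‖₊ : ℝ≥0∞) ≤ (q : ℝ≥0∞) ^ (k : ℝ) := by
    have := ENNReal.rpow_le_rpow hk.le (Nat.cast_nonneg (α := ℝ) k)
    rwa [← ENNReal.rpow_mul, one_div, inv_mul_cancel₀ (by positivity), ENNReal.rpow_one] at this
  rw [ENNReal.rpow_natCast, ← hpow] at h1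
  exact_mod_cast h1

theorem SchurStable.summable_conj_pow [Nonempty ι] {F : Matrix ι ι ℝ} (hF : SchurStable F)
    (W : Matrix ι ι ℝ) : Summable fun k : ℕ => F ^ k * W * (F ^ k)ᵀ := by
  obtain ⟨q, hq, hq1, hk⟩ := hF.exists_norm_pow_le
  have hg : Summable fun k : ℕ => ‖W‖ * (q ^ 2) ^ k :=
    (summable_geometric_of_lt_one (by positivity) (by nlinarith)).mul_left _
  refine Summable.of_norm_bounded_eventually_nat hg ?_
  filter_upwards [hk] with k hk
  calc ‖F ^ k * W * (F ^ k)ᵀ‖ ≤ ‖F ^ k‖ * ‖W‖ * ‖(F ^ k)ᵀ‖ :=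
        (frobenius_norm_mul _ _).trans
          (mul_le_mul_of_nonneg_right (frobenius_norm_mul _ _) (norm_nonneg _))
    _ = ‖F ^ k‖ * ‖W‖ * ‖F ^ k‖ := by rw [frobenius_norm_transpose]
    _ ≤ q ^ k * ‖W‖ * q ^ k := by gcongr
    _ = ‖W‖ * (q ^ 2) ^ k := by ring

end Frobenius

theorem Matrix.nonneg_of_tendsto {X : ℕ → Matrix ι ι ℝ} {L : Matrix ι ι ℝ}
    (hX : ∀ᶠ k in atTop, 0 ≤ X k) (h : Tendsto X atTop (𝓝 L)) : 0 ≤ L := by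
  refine nonneg_of_quadratic ?_ fun x => ?_
  · have h1 : Tendsto (fun k => (X k)ᵀ) atTop (𝓝 Lᵀ) :=
      (continuous_id.matrix_transpose.tendsto L).comp h
    refine tendsto_nhds_unique h1 (h.congr' ?_)
    filter_upwards [hX] with k hk using (transpose_eq_of_nonneg hk).symm
  · have hc : Continuous fun M : Matrix ι ι ℝ => x ⬝ᵥ (M *ᵥ x) :=
      continuous_const.dotProduct (continuous_id.matrix_mulVec continuous_const)
    refine ge_of_tendsto ((hc.tendsto L).comp h) ?_
    filter_upwards [hX] with k hk
    simpa using quadratic_le hk x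

/-- Solvability of the discrete Lyapunov equation for a Schur stable matrix. -/
theorem SchurStable.exists_lyapunov [Nonempty ι] {F : Matrix ι ι ℝ} (hF : SchurStable F)
    {W : Matrix ι ι ℝ} (hW : 0 ≤ W) : ∃ X : Matrix ι ι ℝ, 0 ≤ X ∧ F * X * Fᵀ + W = X := by
  have hs := hF.summable_conj_pow W
  -- Conjugating the series by `F` shifts its index by one; the missing zeroth term is `W`.
  refine ⟨∑' k : ℕ, F ^ k * W * (F ^ k)ᵀ, ?_, ?_⟩
  · exact nonneg_of_tendsto
      (Eventually.of_forall fun k => Finset.sum_nonneg fun i _ => conj_nonneg hW _)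
      hs.hasSum.tendsto_sum_nat
  · have h1 : F * (∑' k : ℕ, F ^ k * W * (F ^ k)ᵀ) * Fᵀ
        = ∑' k : ℕ, F ^ (k + 1) * W * (F ^ (k + 1))ᵀ := by
      rw [← hs.tsum_mul_left F, ← (hs.mul_left F).tsum_mul_right]
      refine tsum_congr fun k => ?_
      rw [pow_succ', transpose_mul]
      simp only [Matrix.mul_assoc]
    rw [h1, hs.tsum_eq_zero_add, add_comm]
    simp

/-- Each quadratic form is a bounded monotone real sequence; polarization recovers the entries. -/
theorem Matrix.exists_tendsto_of_monotone {X : ℕ → Matrix ι ι ℝ} (hX : Monotone X)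
    {B : Matrix ι ι ℝ} (h0 : ∀ k, 0 ≤ X k) (hB : ∀ k, X k ≤ B) :
    ∃ L, Tendsto X atTop (𝓝 L) := by
  have hq : ∀ x : ι → ℝ, ∃ l, Tendsto (fun k => x ⬝ᵥ (X k *ᵥ x)) atTop (𝓝 l) := fun x =>
    ⟨_, tendsto_atTop_ciSup (fun i j hij => quadratic_le (hX hij) x)
      ⟨x ⬝ᵥ (B *ᵥ x), by rintro _ ⟨k, rfl⟩; exact quadratic_le (hB k) x⟩⟩
  have he : ∀ i j, ∃ l, Tendsto (fun k => X k i j) atTop (𝓝 l) := fun i j => by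
    obtain ⟨a, ha⟩ := hq (Pi.single i 1 + Pi.single j 1)
    obtain ⟨b, hb⟩ := hq (Pi.single i 1)
    obtain ⟨c, hc⟩ := hq (Pi.single j 1)
    refine ⟨(a - b - c) / 2, (((ha.sub hb).sub hc).div_const 2).congr fun k => ?_⟩
    have hs : X k j i = X k i j := congrFun (congrFun (transpose_eq_of_nonneg (h0 k)) i) j
    simp [mulVec_add, dotProduct_add, add_dotProduct, hs]
    ring
  choose l hl using he
  exact ⟨Matrix.of l, tendsto_pi_nhds.2 fun i => tendsto_pi_nhds.2 fun j => hl i j⟩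

variable {A : Matrix ι ι ℝ} {C : Matrix κ ι ℝ} {Q : Matrix ι ι ℝ} {R : Matrix κ κ ℝ}

theorem continuousAt_riccati (hR : R.PosDef) {P : Matrix ι ι ℝ} (hP : 0 ≤ P) :
    ContinuousAt (riccati A C Q R) P := by
  have hS := (isUnit_iff_isUnit_det _).1 (innovation_posDef (C := C) hR hP).isUnit
  have hinv : ContinuousAt (fun P : Matrix ι ι ℝ => (C * P * Cᵀ + R)⁻¹) P := by
    have h1 : ContinuousAt (Inv.inv : Matrix κ κ ℝ → _) (C * P * Cᵀ + R) :=
      continuousAt_matrix_inv _ (NormedRing.inverse_continuousAt hS.unit)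
    have h2 : Continuous fun P : Matrix ι ι ℝ => C * P * Cᵀ + R := by fun_prop
    exact ContinuousAt.comp (f := fun P : Matrix ι ι ℝ => C * P * Cᵀ + R) h1 h2.continuousAt
  unfold riccati
  have h3 : ContinuousAt (fun P : Matrix ι ι ℝ =>
      A * P * Cᵀ * (C * P * Cᵀ + R)⁻¹ * C * P * Aᵀ) P := by
    have hg : Continuous fun Z : Matrix ι ι ℝ × Matrix κ κ ℝ =>
        A * Z.1 * Cᵀ * Z.2 * C * Z.1 * Aᵀ := by fun_prop
    exact ContinuousAt.comp (f := fun P : Matrix ι ι ℝ => (P, (C * P * Cᵀ + R)⁻¹))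
      hg.continuousAt (continuousAt_id.prodMk hinv)
  have h4 : Continuous fun P : Matrix ι ι ℝ => A * P * Aᵀ + Q := by fun_prop
  exact h4.continuousAt.sub h3

/-- The Lyapunov solution `X` is a fixed point of the Joseph update with the stabilizing gain, hence
bounds the increasing Riccati iterates from 0. -/
theorem Detectable.exists_isRiccatiSolution [Nonempty ι] (hdet : Detectable A C)
    (hQ : Q.PosDef) (hR : R.PosDef) : ∃ P, IsRiccatiSolution A C Q R P := by
  obtain ⟨K, hK⟩ := hdet
  obtain ⟨X, hX, hXeq⟩ := hK.exists_lyapunov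
    (W := Q + K * R * Kᵀ) (add_nonneg hQ.posSemidef.nonneg (conj_nonneg hR.posSemidef.nonneg K))
  have hXj : josephUpdate A C Q R K X = X := by
    rw [josephUpdate, add_assoc, hXeq]
  set g := riccati A C Q R
  have h0 : ∀ k, 0 ≤ g^[k] 0 := fun k => by
    induction k with
    | zero => simp
    | succ k ih =>
      rw [Function.iterate_succ_apply']
      exact hQ.posSemidef.nonneg.trans (le_riccati hR ih)
  have hmono : Monotone fun k => g^[k] 0 := by
    refine monotone_nat_of_le_succ fun k => ?_
    induction k with
    | zero => exact h0 1
    | succ k ih =>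
      rw [Function.iterate_succ_apply', Function.iterate_succ_apply']
      exact riccati_mono hR (h0 k) ih
  have hB : ∀ k, g^[k] 0 ≤ X := fun k => by
    induction k with
    | zero => exact hX
    | succ k ih =>
      rw [Function.iterate_succ_apply', ← hXj]
      exact (riccati_le_josephUpdate hR (h0 k) K).trans (josephUpdate_mono ih K)
  obtain ⟨P, hP⟩ := exists_tendsto_of_monotone hmono h0 hB
  have hP0 : 0 ≤ P := nonneg_of_tendsto (Eventually.of_forall h0) hP
  refine ⟨P, hP0.posSemidef, ?_⟩
  have h1 := (tendsto_add_atTop_iff_nat 1).2 hP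
  have h2 : Tendsto (fun k => g (g^[k] 0)) atTop (𝓝 (g P)) :=
    (continuousAt_riccati hR hP0).tendsto.comp hP
  refine tendsto_nhds_unique h1 (h2.congr fun k => ?_)
  rw [Function.iterate_succ_apply']

theorem IsRiccatiSolution.nonneg {P : Matrix ι ι ℝ} (h : IsRiccatiSolution A C Q R P) : 0 ≤ P :=
  h.1.nonneg

theorem IsRiccatiSolution.posDef {P : Matrix ι ι ℝ} (hQ : Q.PosDef) (hR : R.PosDef)
    (h : IsRiccatiSolution A C Q R P) : P.PosDef := by
  rw [h.2]
  exact posDef_of_le hQ (le_riccati hR h.nonneg)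

theorem IsRiccatiSolution.exists_contraction [Nonempty ι] {P : Matrix ι ι ℝ} (hQ : Q.PosDef)
    (hR : R.PosDef) (h : IsRiccatiSolution A C Q R P) : ∃ ρ : ℝ, 0 ≤ ρ ∧ ρ < 1 ∧
      (A - kalmanGain A C R P * C) * P * (A - kalmanGain A C R P * C)ᵀ ≤ ρ • P := by
  have hPd := h.posDef hQ hR
  have hQP : Q ≤ P := by
    conv_rhs => rw [h.2]
    exact le_riccati hR h.nonneg
  have ha := lamMin_pos hQ
  have hab := lamMin_le_lamMax_of_le hQ.isHermitian hPd.isHermitian hQP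
  have hb := ha.trans_le hab
  refine ⟨1 - lamMin Q / lamMax P, sub_nonneg.2 ((div_le_one hb).2 hab),
    sub_lt_self _ (by positivity), ?_⟩
  have := closedLoop_conj_le_smul (A := A) (C := C) (Q := Q) hR h.nonneg ha.le hb
    (lamMin_smul_one_le hQ.isHermitian) (by rw [← h.2]; exact le_lamMax_smul_one hPd.isHermitian)
  rwa [← h.2] at this

/-- The difference satisfies P - P' ≤ F (P - P') Fᵀ with F the closed loop at `P'`. Iteration bounds
it by arbitrarily small multiples of `P'`. -/
theorem IsRiccatiSolution.le [Nonempty ι] {P P' : Matrix ι ι ℝ} (hQ : Q.PosDef)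
    (hR : R.PosDef) (h : IsRiccatiSolution A C Q R P) (h' : IsRiccatiSolution A C Q R P') :
    P ≤ P' := by
  obtain ⟨ρ, hρ, hρ1, hcon⟩ := h'.exists_contraction hQ hR
  have hD : (P - P').IsHermitian := h.1.isHermitian.sub h'.1.isHermitian
  obtain ⟨c, hc, hcP⟩ := exists_le_smul_of_posDef hD (h'.posDef hQ hR)
  rw [← sub_nonpos]
  refine nonpos_of_le_geometric (P := P') (c := c) hD hρ hρ1 fun k => ?_
  refine le_smul_geometric_of_conj_le (D := fun _ => P - P') (P := fun _ => P')
    (F := fun _ => A - kalmanGain A C R P' * C) hc hρ hcP k (fun _ _ => ?_) fun _ _ => hcon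
  have := riccati_sub_le (A := A) (C := C) (Q := Q) hR h.nonneg h'.nonneg
  rwa [← h.2, ← h'.2] at this

theorem Detectable.existsUnique_isRiccatiSolution [Nonempty ι] (hdet : Detectable A C)
    (hQ : Q.PosDef) (hR : R.PosDef) : ∃! P, IsRiccatiSolution A C Q R P := by
  obtain ⟨P, hP⟩ := hdet.exists_isRiccatiSolution hQ hR
  exact ⟨P, hP, fun P' hP' => (hP'.le hQ hR hP).antisymm (hP.le hQ hR hP')⟩

end Stability

/-! ### From order bounds to spectral norm bounds. -/

section SpectralNorm

open scoped MatrixOrder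
open Matrix

variable {ι : Type*} [Fintype ι] [DecidableEq ι]

theorem specNorm_transpose (M : Matrix ι ι ℝ) : specNorm Mᵀ = specNorm M := by
  have : Mᵀ = star M := by
    rw [star_eq_conjTranspose, conjTranspose_eq_transpose_of_trivial]
  rw [specNorm, this, map_star, specNorm]
  exact norm_star (Matrix.toEuclideanCLM (n := ι) (𝕜 := ℝ) M)

theorem specNorm_sq_le_of_mul_transpose_le {M : Matrix ι ι ℝ} {c : ℝ} (hc : 0 ≤ c)
    (h : M * Mᵀ ≤ c • 1) : specNorm M ^ 2 ≤ c := by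
  rw [← specNorm_transpose]
  refine (Real.le_sqrt (norm_nonneg _) hc).1 ?_
  refine ContinuousLinearMap.opNorm_le_bound _ (Real.sqrt_nonneg c) fun x => ?_
  have h1 : ‖Matrix.toEuclideanCLM (n := ι) (𝕜 := ℝ) Mᵀ x‖ ^ 2 ≤ c * ‖x‖ ^ 2 := by
    have h2 := quadratic_le h x.ofLp
    rw [← mulVec_mulVec, dotProduct_mulVec, ← mulVec_transpose, smul_mulVec, one_mulVec,
      dotProduct_smul, smul_eq_mul] at h2
    rw [EuclideanSpace.real_norm_sq_eq, EuclideanSpace.real_norm_sq_eq]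
    simpa [dotProduct, sq] using h2
  calc _ ≤ Real.sqrt (c * ‖x‖ ^ 2) := Real.le_sqrt_of_sq_le h1
    _ = _ := by rw [Real.sqrt_mul hc, Real.sqrt_sq (norm_nonneg _)]

theorem specNorm_le_of_nonneg_of_le {X : Matrix ι ι ℝ} {c : ℝ} (hc : 0 ≤ c) (h0 : 0 ≤ X)
    (h : X ≤ c • 1) : specNorm X ≤ c := by
  -- The symmetric square root reduces the claim to the bound on M Mᵀ with M = B.
  obtain ⟨B, hB, rfl⟩ : ∃ B : Matrix ι ι ℝ, 0 ≤ B ∧ B * B = X :=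
    ⟨CFC.sqrt X, CFC.sqrt_nonneg X, CFC.sqrt_mul_sqrt_self X h0⟩
  have hBt := transpose_eq_of_nonneg hB
  have h1 : specNorm (B * B) ≤ specNorm B * specNorm B := by
    rw [specNorm, map_mul]
    exact norm_mul_le _ _
  refine h1.trans ?_
  rw [← sq]
  exact specNorm_sq_le_of_mul_transpose_le hc (by rwa [hBt])

theorem specNorm_sub_comm (X Y : Matrix ι ι ℝ) : specNorm (X - Y) = specNorm (Y - X) := by
  rw [← neg_sub, specNorm, map_neg, norm_neg, specNorm]

theorem exists_le_smul_one {X : Matrix ι ι ℝ} (hX : 0 ≤ X) : ∃ e : ℝ, 0 ≤ e ∧ X ≤ e • 1 := by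
  refine ⟨|lamMax X|, abs_nonneg _, (le_lamMax_smul_one hX.posSemidef.isHermitian).trans ?_⟩
  exact smul_le_smul_of_scalar_le PosSemidef.one.nonneg (le_abs_self _)

theorem eq_zero_of_conj_eq_zero {κ : Type*} {X : Matrix ι ι ℝ} (hX : X.PosDef)
    {F : Matrix κ ι ℝ} (h : F * X * Fᵀ = 0) : F = 0 := by
  ext i j
  by_contra hij
  have hne : F i ≠ 0 := fun h0 => hij (congrFun h0 j)
  have h1 := hX.dotProduct_mulVec_pos hne
  have h2 : F i ⬝ᵥ (X *ᵥ F i) = (F * X * Fᵀ) i i := by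
    rw [Matrix.mul_assoc, mul_apply]
    rfl
  rw [star_trivial, h2, h] at h1
  exact lt_irrefl _ h1

end SpectralNorm

/-! ### Covariances of the delayed filter: monotonicity, convergence and decay of the transition
matrix. -/

namespace TwoSourceModel

open scoped MatrixOrder
open Matrix

variable {n m m' : ℕ} {S : TwoSourceModel n m m'} {Pbar P : Matrix (Fin n) (Fin n) ℝ}

theorem Rbar_posDef (hR : S.R.PosDef) (hRe : S.Re.PosDef) : S.Rbar.PosDef := by
  refine .of_dotProduct_mulVec_pos ?_ fun x hx => ?_
  · have h1 : S.Rᵀ = S.R := transpose_eq_of_nonneg hR.posSemidef.nonneg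
    have h2 : S.Reᵀ = S.Re := transpose_eq_of_nonneg hRe.posSemidef.nonneg
    simp [Matrix.IsHermitian, Rbar, fromBlocks_transpose, h1, h2]
  · have hsplit : star x ⬝ᵥ (S.Rbar *ᵥ x) = (x ∘ Sum.inl) ⬝ᵥ (S.R *ᵥ (x ∘ Sum.inl))
        + (x ∘ Sum.inr) ⬝ᵥ (S.Re *ᵥ (x ∘ Sum.inr)) := by
      rw [Rbar, fromBlocks_mulVec]
      simp [dotProduct, Fintype.sum_sum_type]
    have h1 := hR.posSemidef.dotProduct_mulVec_nonneg (x ∘ Sum.inl)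
    have h2 := hRe.posSemidef.dotProduct_mulVec_nonneg (x ∘ Sum.inr)
    simp only [star_trivial] at h1 h2
    rw [hsplit]
    by_cases hl : x ∘ Sum.inl = 0
    · have hr : x ∘ Sum.inr ≠ 0 := fun hr => hx <| by
        ext (i | i)
        · exact congrFun hl i
        · exact congrFun hr i
      have := hRe.dotProduct_mulVec_pos hr
      simp only [star_trivial] at this
      linarith
    · have := hR.dotProduct_mulVec_pos hl
      simp only [star_trivial] at this
      linarith

/-- A gain for the local observations, regarded as one for the centralized observations. -/
def localGain (m' : ℕ) (K : Matrix (Fin n) (Fin m) ℝ) : Matrix (Fin n) (Fin m ⊕ Fin m') ℝ :=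
  fromCols K 0

theorem localGain_mul_Cbar (K : Matrix (Fin n) (Fin m) ℝ) :
    localGain m' K * S.Cbar = K * S.C := by
  rw [localGain, Cbar, fromCols_mul_fromRows, Matrix.zero_mul, add_zero]

theorem localGain_mul_Rbar (K : Matrix (Fin n) (Fin m) ℝ) :
    localGain m' K * S.Rbar = localGain m' (K * S.R) := by
  rw [localGain, Rbar, fromCols_mul_fromBlocks]
  simp [localGain]

theorem detectable_Cbar (h : Detectable S.A S.C) : Detectable S.A S.Cbar := by
  obtain ⟨K, hK⟩ := h
  exact ⟨localGain m' K, by rwa [localGain_mul_Cbar]⟩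

theorem josephUpdate_localGain (K : Matrix (Fin n) (Fin m) ℝ) (X : Matrix (Fin n) (Fin n) ℝ) :
    josephUpdate S.A S.Cbar S.Q S.Rbar (localGain m' K) X = josephUpdate S.A S.C S.Q S.R K X := by
  rw [josephUpdate, josephUpdate, localGain_mul_Cbar, localGain_mul_Rbar,
    localGain, localGain, transpose_fromCols, fromCols_mul_fromRows, Matrix.zero_mul, add_zero]

theorem cov_succ (j : ℕ) : S.cov Pbar (j + 1) = riccati S.A S.C S.Q S.R (S.cov Pbar j) := by
  rw [cov, Function.iterate_succ_apply', cov]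

theorem cov_zero : S.cov Pbar 0 = Pbar := rfl

theorem cov_nonneg (hQ : S.Q.PosDef) (hR : S.R.PosDef) (h : 0 ≤ Pbar) (j : ℕ) :
    0 ≤ S.cov Pbar j := by
  induction j with
  | zero => exact h
  | succ j ih => rw [cov_succ]; exact hQ.posSemidef.nonneg.trans (le_riccati hR ih)

/-- Ignoring the external source is a suboptimal choice for the centralized filter: the padded local
Kalman gain has the local Riccati value as its centralized Joseph update. -/
theorem le_local_riccati (hR : S.R.PosDef) (hRe : S.Re.PosDef)
    (h : IsRiccatiSolution S.A S.Cbar S.Q S.Rbar Pbar) :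
    Pbar ≤ riccati S.A S.C S.Q S.R Pbar := by
  conv_lhs => rw [h.2]
  rw [← josephUpdate_kalmanGain hR h.nonneg, ← josephUpdate_localGain]
  exact riccati_le_josephUpdate (Rbar_posDef hR hRe) h.nonneg _

theorem cov_monotone (hQ : S.Q.PosDef) (hR : S.R.PosDef) (hRe : S.Re.PosDef)
    (h : IsRiccatiSolution S.A S.Cbar S.Q S.Rbar Pbar) : Monotone (S.cov Pbar) := by
  refine monotone_nat_of_le_succ fun j => ?_
  induction j with
  | zero => rw [cov_succ]; exact le_local_riccati hR hRe h
  | succ j ih =>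
    rw [cov_succ, cov_succ (j := j + 1)]
    exact riccati_mono hR (cov_nonneg hQ hR h.nonneg j) ih

theorem Q_le_cov (hQ : S.Q.PosDef) (hR : S.R.PosDef) (hRe : S.Re.PosDef)
    (h : IsRiccatiSolution S.A S.Cbar S.Q S.Rbar Pbar) (j : ℕ) : S.Q ≤ S.cov Pbar j := by
  refine le_trans ?_ (cov_monotone hQ hR hRe h (Nat.zero_le j))
  rw [cov_zero, h.2]
  exact le_riccati (Rbar_posDef hR hRe) h.nonneg

theorem cov_posDef (hQ : S.Q.PosDef) (hR : S.R.PosDef) (hRe : S.Re.PosDef)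
    (h : IsRiccatiSolution S.A S.Cbar S.Q S.Rbar Pbar) (j : ℕ) : (S.cov Pbar j).PosDef :=
  posDef_of_le hQ (Q_le_cov hQ hR hRe h j)

theorem Phi_succ (d : ℕ) :
    S.Phi Pbar (d + 1) = (S.A - S.gain Pbar d * S.C) * S.Phi Pbar d := by
  rw [Phi, transition, Nat.zero_add, Phi]

variable [Nonempty (Fin n)]

/-- The centralized steady-state covariance is dominated by the local one. -/
theorem central_le_local (hQ : S.Q.PosDef) (hR : S.R.PosDef) (hRe : S.Re.PosDef)
    (h : IsRiccatiSolution S.A S.Cbar S.Q S.Rbar Pbar)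
    (hP : IsRiccatiSolution S.A S.C S.Q S.R P) : Pbar ≤ P := by
  obtain ⟨ρ, hρ, hρ1, hcon⟩ := hP.exists_contraction hQ hR
  have hD : (Pbar - P).IsHermitian := h.1.isHermitian.sub hP.1.isHermitian
  obtain ⟨c, hc, hcP⟩ := exists_le_smul_of_posDef hD (hP.posDef hQ hR)
  rw [← sub_nonpos]
  refine nonpos_of_le_geometric (P := P) (c := c) hD hρ hρ1 fun k => ?_
  -- `Pbar` lies below every iterate, so it suffices to bound the k-th iterate minus `P`
  -- geometrically.
  refine (sub_le_sub_right (cov_monotone hQ hR hRe h (Nat.zero_le k)) P).trans ?_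
  refine le_smul_geometric_of_conj_le (D := fun j => S.cov Pbar j - P) (P := fun _ => P)
    (F := fun _ => S.A - kalmanGain S.A S.C S.R P * S.C) hc hρ hcP k (fun j _ => ?_)
    fun _ _ => hcon
  have := riccati_sub_le (A := S.A) (C := S.C) (Q := S.Q) hR (cov_nonneg hQ hR h.nonneg j)
    hP.nonneg
  rwa [← hP.2, ← cov_succ] at this

theorem cov_le_local (hQ : S.Q.PosDef) (hR : S.R.PosDef) (hRe : S.Re.PosDef)
    (h : IsRiccatiSolution S.A S.Cbar S.Q S.Rbar Pbar)
    (hP : IsRiccatiSolution S.A S.C S.Q S.R P) (j : ℕ) : S.cov Pbar j ≤ P := by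
  induction j with
  | zero => exact central_le_local hQ hR hRe h hP
  | succ j ih =>
    rw [cov_succ, hP.2]
    exact riccati_mono hR (cov_nonneg hQ hR h.nonneg j) ih

theorem closedLoop_conj_cov_le (hQ : S.Q.PosDef) (hR : S.R.PosDef)
    (h : IsRiccatiSolution S.A S.Cbar S.Q S.Rbar Pbar) {b : ℝ} (hb : 0 < b) {j : ℕ}
    (hj : S.cov Pbar (j + 1) ≤ b • 1) :
    (S.A - S.gain Pbar j * S.C) * S.cov Pbar j * (S.A - S.gain Pbar j * S.C)ᵀ
      ≤ (1 - lamMin S.Q / b) • S.cov Pbar (j + 1) := by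
  rw [cov_succ] at hj ⊢
  exact closedLoop_conj_le_smul hR (cov_nonneg hQ hR h.nonneg j) (lamMin_pos hQ).le hb
    (lamMin_smul_one_le hQ.isHermitian) hj

theorem lamMin_Q_le (hQ : S.Q.PosDef) (hR : S.R.PosDef) (hRe : S.Re.PosDef)
    (h : IsRiccatiSolution S.A S.Cbar S.Q S.Rbar Pbar) {b : ℝ} {j : ℕ}
    (hj : S.cov Pbar j ≤ b • 1) : lamMin S.Q ≤ b :=
  scalar_le_of_smul_one_le <| (lamMin_smul_one_le hQ.isHermitian).trans
    ((Q_le_cov hQ hR hRe h j).trans hj)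

/-- The bound `b` is left free to serve twice: b = λ_max(P^(d+1)) gives the explicit rate, b =
λ_max(P) one independent of d. -/
theorem specNorm_Phi_sq_le (hQ : S.Q.PosDef) (hR : S.R.PosDef) (hRe : S.Re.PosDef)
    (h : IsRiccatiSolution S.A S.Cbar S.Q S.Rbar Pbar) {b : ℝ} {d : ℕ}
    (hb : S.cov Pbar d ≤ b • 1) :
    specNorm (S.Phi Pbar d) ^ 2 ≤ b / lamMin (S.cov Pbar 0) * (1 - lamMin S.Q / b) ^ d := by
  have hq := lamMin_pos hQ
  have hqb := lamMin_Q_le hQ hR hRe h hb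
  have hb0 : 0 < b := hq.trans_le hqb
  have hρ : 0 ≤ 1 - lamMin S.Q / b := sub_nonneg.2 ((div_le_one hb0).2 hqb)
  have hPd := cov_posDef hQ hR hRe h 0
  have hp := lamMin_pos hPd
  -- Φ_j P̄ Φ_jᵀ satisfies the conjugation recursion with equality and starts at P̄, so the constant
  -- is 1.
  have key := le_smul_geometric_of_conj_le
    (D := fun j => S.Phi Pbar j * S.cov Pbar 0 * (S.Phi Pbar j)ᵀ) (P := S.cov Pbar)
    (F := fun j => S.A - S.gain Pbar j * S.C) zero_le_one hρ
    (by simp [Phi, transition]) d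
    (fun j _ => by
      rw [Phi_succ, transpose_mul]
      simp only [Matrix.mul_assoc, le_refl])
    -- By monotonicity a bound on the last covariance bounds all earlier ones, so one ratio serves
    -- every step.
    (fun j hj => closedLoop_conj_cov_le hQ hR h hb0
      ((cov_monotone hQ hR hRe h (Nat.succ_le_of_lt hj)).trans hb))
  rw [one_mul] at key
  refine specNorm_sq_le_of_mul_transpose_le (by positivity) ?_
  have h1 : lamMin (S.cov Pbar 0) • (S.Phi Pbar d * (S.Phi Pbar d)ᵀ)
      ≤ ((1 - lamMin S.Q / b) ^ d * b) • 1 := by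
    calc _ = S.Phi Pbar d * (lamMin (S.cov Pbar 0) • 1) * (S.Phi Pbar d)ᵀ := by simp
      _ ≤ _ := conj_le_conj (lamMin_smul_one_le hPd.isHermitian) _
      _ ≤ _ := key
      _ ≤ _ := smul_le_smul_matrix hb (by positivity)
      _ = _ := by rw [smul_smul]
  have h2 := smul_le_smul_matrix h1 (inv_nonneg.2 hp.le)
  rw [smul_smul, smul_smul, inv_mul_cancel₀ hp.ne', one_smul] at h2
  convert h2 using 2
  field_simp

theorem innovationCov_converges (hQ : S.Q.PosDef) (hR : S.R.PosDef) (hRe : S.Re.PosDef)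
    (h : IsRiccatiSolution S.A S.Cbar S.Q S.Rbar Pbar)
    (hP : IsRiccatiSolution S.A S.C S.Q S.R P) : ∃ M γ : ℝ, 0 < γ ∧ γ < 1 ∧
      ∀ d, specNorm (S.innovationCov Pbar d - (S.C * P * S.Cᵀ + S.R)) ≤ M * γ ^ d := by
  have hPd := hP.posDef hQ hR
  have hq := lamMin_pos hQ
  have hb : ∀ j, S.cov Pbar j ≤ lamMax P • 1 := fun j =>
    (cov_le_local hQ hR hRe h hP j).trans (le_lamMax_smul_one hPd.isHermitian)
  have hqb := lamMin_Q_le hQ hR hRe h (hb 0)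
  have hb0 : 0 < lamMax P := hq.trans_le hqb
  set ρ := 1 - lamMin S.Q / lamMax P with hρd
  have hρ : 0 ≤ ρ := sub_nonneg.2 ((div_le_one hb0).2 hqb)
  have hρ1 : ρ < 1 := sub_lt_self _ (by positivity)
  obtain ⟨c, hc, hcP⟩ := exists_le_smul_of_posDef
    (hP.1.isHermitian.sub h.1.isHermitian) (cov_posDef hQ hR hRe h 0)
  -- The comparison uses the time-varying closed loops at the iterates, whose contraction ratio is
  -- uniform because all iterates lie below `P`.
  have key : ∀ d, P - S.cov Pbar d ≤ (c * ρ ^ d) • S.cov Pbar d := fun d =>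
    le_smul_geometric_of_conj_le (D := fun j => P - S.cov Pbar j) (P := S.cov Pbar)
      (F := fun j => S.A - S.gain Pbar j * S.C) hc hρ hcP d
      (fun j _ => by
        have := riccati_sub_le (A := S.A) (C := S.C) (Q := S.Q) hR hP.nonneg
          (cov_nonneg hQ hR h.nonneg j)
        rwa [← hP.2, ← cov_succ] at this)
      (fun j _ => closedLoop_conj_cov_le hQ hR h hb0 (hb _))
  obtain ⟨e, he, heC⟩ := exists_le_smul_one (conj_nonneg hPd.posSemidef.nonneg S.C)
  -- ρ can vanish while the rate must be positive; the midpoint of ρ and 1 is a safe choice.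
  refine ⟨c * e, (1 + ρ) / 2, by positivity, by linarith, fun d => ?_⟩
  have h1 : S.C * (P - S.cov Pbar d) * S.Cᵀ ≤ (c * ρ ^ d * e) • 1 := by
    calc _ ≤ S.C * ((c * ρ ^ d) • P) * S.Cᵀ := conj_le_conj ((key d).trans
            (smul_le_smul_matrix (cov_le_local hQ hR hRe h hP d) (by positivity))) _
      _ = (c * ρ ^ d) • (S.C * P * S.Cᵀ) := by simp
      _ ≤ _ := smul_le_smul_matrix heC (by positivity)
      _ = _ := by rw [smul_smul]
  have h2 : specNorm (S.C * (P - S.cov Pbar d) * S.Cᵀ) ≤ c * ρ ^ d * e :=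
    specNorm_le_of_nonneg_of_le (by positivity)
      (conj_nonneg (sub_nonneg.2 (cov_le_local hQ hR hRe h hP d)) _) h1
  rw [specNorm_sub_comm, innovationCov]
  have h3 : S.C * P * S.Cᵀ + S.R - (S.C * S.cov Pbar d * S.Cᵀ + S.R)
      = S.C * (P - S.cov Pbar d) * S.Cᵀ := by
    rw [Matrix.mul_sub, Matrix.sub_mul]
    abel
  rw [h3]
  calc _ ≤ c * ρ ^ d * e := h2
    _ = c * e * ρ ^ d := by ring
    _ ≤ c * e * ((1 + ρ) / 2) ^ d := by gcongr; linarith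

theorem specNorm_Phi_sq_exponential (hQ : S.Q.PosDef) (hR : S.R.PosDef) (hRe : S.Re.PosDef)
    (h : IsRiccatiSolution S.A S.Cbar S.Q S.Rbar Pbar)
    (hP : IsRiccatiSolution S.A S.C S.Q S.R P) : ∃ M γ : ℝ, 0 < γ ∧ γ < 1 ∧
      ∀ d, specNorm (S.Phi Pbar d) ^ 2 ≤ M * γ ^ d := by
  have hPd := hP.posDef hQ hR
  have hq := lamMin_pos hQ
  have hb : ∀ j, S.cov Pbar j ≤ lamMax P • 1 := fun j =>
    (cov_le_local hQ hR hRe h hP j).trans (le_lamMax_smul_one hPd.isHermitian)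
  have hqb := lamMin_Q_le hQ hR hRe h (hb 0)
  have hb0 : 0 < lamMax P := hq.trans_le hqb
  have hp := lamMin_pos (cov_posDef hQ hR hRe h 0)
  have hρ : 0 ≤ 1 - lamMin S.Q / lamMax P := sub_nonneg.2 ((div_le_one hb0).2 hqb)
  have hρ1 : 1 - lamMin S.Q / lamMax P < 1 := sub_lt_self _ (by positivity)
  refine ⟨lamMax P / lamMin (S.cov Pbar 0), (1 + (1 - lamMin S.Q / lamMax P)) / 2,
    by linarith, by linarith, fun d => (specNorm_Phi_sq_le hQ hR hRe h (hb d)).trans ?_⟩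
  gcongr
  linarith

/-- If the process noise covariance saturates the bound by `P^{(d+1)}`, the system is trivial. -/
theorem eq_zero_of_lamMin_eq_lamMax (hQ : S.Q.PosDef) (hR : S.R.PosDef) (hRe : S.Re.PosDef)
    (h : IsRiccatiSolution S.A S.Cbar S.Q S.Rbar Pbar) {d : ℕ}
    (heq : lamMin S.Q = lamMax (S.cov Pbar d)) : S.A = 0 ∧ ∃ q : ℝ, S.Q = q • 1 := by
  have hcd := (cov_posDef hQ hR hRe h d).isHermitian
  have h1 : S.cov Pbar d ≤ lamMin S.Q • 1 := heq ▸ le_lamMax_smul_one hcd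
  have h2 := lamMin_smul_one_le hQ.isHermitian
  have hQeq : S.Q = lamMin S.Q • 1 := ((Q_le_cov hQ hR hRe h d).trans h1).antisymm h2
  refine ⟨?_, _, hQeq⟩
  have hPQ : Pbar = S.Q :=
    ((cov_monotone hQ hR hRe h (Nat.zero_le d)).trans (h1.trans h2)).antisymm
      (Q_le_cov hQ hR hRe h 0)
  have hRb := Rbar_posDef hR hRe
  have hj := josephUpdate_kalmanGain (A := S.A) (C := S.Cbar) (Q := S.Q) hRb h.nonneg
  rw [← h.2, josephUpdate] at hj
  set L := kalmanGain S.A S.Cbar S.Rbar Pbar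
  set F := S.A - L * S.Cbar with hF
  -- Since P̄ = Q, the Joseph form of the fixed point equation leaves no room for its two
  -- nonnegative terms. Both vanish, so F = 0 and L = 0, and A = F + L C̄ = 0.
  have h3 : F * Pbar * Fᵀ + L * S.Rbar * Lᵀ = 0 := by
    have : F * Pbar * Fᵀ + S.Q + L * S.Rbar * Lᵀ = S.Q := hj.trans hPQ
    have h4 : F * Pbar * Fᵀ + L * S.Rbar * Lᵀ + S.Q = 0 + S.Q := by
      rw [zero_add]
      conv_rhs => rw [← this]
      abel
    exact add_right_cancel h4
  have hF0 := conj_nonneg h.nonneg F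
  have hL0 := conj_nonneg hRb.posSemidef.nonneg L
  have hFz : F * Pbar * Fᵀ = 0 := le_antisymm (by rw [← h3]; exact le_add_of_nonneg_right hL0) hF0
  have hLz : L * S.Rbar * Lᵀ = 0 := le_antisymm (by rw [← h3]; exact le_add_of_nonneg_left hF0) hL0
  have hFF := eq_zero_of_conj_eq_zero (h.posDef hQ hRb) hFz
  have hLL := eq_zero_of_conj_eq_zero hRb hLz
  rw [hLL, Matrix.zero_mul, sub_zero] at hF
  rw [← hF, hFF]

end TwoSourceModel

/-! ### Bilinear calculus of cross moments. -/

section Moments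

open Matrix

variable {Ω ι κ ι' : Type*} [Fintype ι] [Fintype κ] [Fintype ι'] [MeasurableSpace Ω]
  {μ : Measure Ω}

theorem memLp_mulVec (M : Matrix κ ι ℝ) {X : Ω → ι → ℝ}
    (hX : ∀ i, MemLp (fun ω => X ω i) 2 μ) (i : κ) :
    MemLp (fun ω => (M *ᵥ X ω) i) 2 μ := by
  simp only [mulVec, dotProduct]
  exact memLp_finsetSum _ fun j _ => (hX j).const_mul (M i j)

theorem IsCenteredL2.mulVec [IsFiniteMeasure μ] (M : Matrix κ ι ℝ) {X : Ω → ι → ℝ}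
    (hX : IsCenteredL2 μ X) : IsCenteredL2 μ fun ω => M *ᵥ X ω := by
  refine ⟨memLp_mulVec M hX.memLp, fun i => ?_⟩
  simp only [Matrix.mulVec, dotProduct]
  rw [integral_finsetSum _ fun j _ =>
    ((hX.memLp j).integrable (by norm_num)).const_mul (M i j)]
  simp [integral_const_mul, hX.mean]

theorem IsCenteredL2.add [IsFiniteMeasure μ] {X Y : Ω → ι → ℝ} (hX : IsCenteredL2 μ X)
    (hY : IsCenteredL2 μ Y) : IsCenteredL2 μ fun ω => X ω + Y ω := by
  refine ⟨fun i => (hX.memLp i).add (hY.memLp i), fun i => ?_⟩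
  have := integral_add ((hX.memLp i).integrable (by norm_num))
    ((hY.memLp i).integrable (by norm_num))
  simpa [hX.mean, hY.mean] using this

theorem IsCenteredL2.sub [IsFiniteMeasure μ] {X Y : Ω → ι → ℝ} (hX : IsCenteredL2 μ X)
    (hY : IsCenteredL2 μ Y) : IsCenteredL2 μ fun ω => X ω - Y ω := by
  refine ⟨fun i => (hX.memLp i).sub (hY.memLp i), fun i => ?_⟩
  have := integral_sub ((hX.memLp i).integrable (by norm_num))
    ((hY.memLp i).integrable (by norm_num))
  simpa [hX.mean, hY.mean] using this

theorem crossMoment_transpose (X : Ω → ι → ℝ) (Y : Ω → κ → ℝ) :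
    (crossMoment μ X Y)ᵀ = crossMoment μ Y X := by
  ext i j
  simp [crossMoment, mul_comm]

theorem crossMoment_eq_zero_comm {X : Ω → ι → ℝ} {Y : Ω → κ → ℝ} (h : crossMoment μ X Y = 0) :
    crossMoment μ Y X = 0 := by
  rw [← crossMoment_transpose, h, transpose_zero]

variable {X X' : Ω → ι → ℝ} {Y Y' : Ω → κ → ℝ} (hX : ∀ i, MemLp (fun ω => X ω i) 2 μ)
  (hX' : ∀ i, MemLp (fun ω => X' ω i) 2 μ) (hY : ∀ i, MemLp (fun ω => Y ω i) 2 μ)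
  (hY' : ∀ i, MemLp (fun ω => Y' ω i) 2 μ)

include hX hY in
theorem crossMoment_mulVec_left (M : Matrix ι' ι ℝ) :
    crossMoment μ (fun ω => M *ᵥ X ω) Y = M * crossMoment μ X Y := by
  ext i j
  simp only [crossMoment, of_apply, Matrix.mul_apply, mulVec, dotProduct, Finset.sum_mul]
  rw [integral_finsetSum _ fun l _ => ?_]
  · simp only [mul_assoc, integral_const_mul]
  · simp only [mul_assoc]
    exact ((hX l).integrable_mul (hY j)).const_mul _

include hX hY in
theorem crossMoment_mulVec_right (M : Matrix ι' κ ℝ) :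
    crossMoment μ X (fun ω => M *ᵥ Y ω) = crossMoment μ X Y * Mᵀ := by
  rw [← crossMoment_transpose, crossMoment_mulVec_left hY hX, transpose_mul,
    crossMoment_transpose]

include hX hX' hY in
theorem crossMoment_add_left :
    crossMoment μ (fun ω => X ω + X' ω) Y = crossMoment μ X Y + crossMoment μ X' Y := by
  ext i j
  simp only [crossMoment, of_apply, Matrix.add_apply, Pi.add_apply, add_mul]
  exact integral_add ((hX i).integrable_mul (hY j)) ((hX' i).integrable_mul (hY j))

include hX hX' hY in
theorem crossMoment_sub_left :
    crossMoment μ (fun ω => X ω - X' ω) Y = crossMoment μ X Y - crossMoment μ X' Y := by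
  ext i j
  simp only [crossMoment, of_apply, Matrix.sub_apply, Pi.sub_apply, sub_mul]
  exact integral_sub ((hX i).integrable_mul (hY j)) ((hX' i).integrable_mul (hY j))

include hX hY hY' in
theorem crossMoment_add_right :
    crossMoment μ X (fun ω => Y ω + Y' ω) = crossMoment μ X Y + crossMoment μ X Y' := by
  rw [← crossMoment_transpose, crossMoment_add_left hY hY' hX, transpose_add,
    crossMoment_transpose, crossMoment_transpose]

end Moments

/-! ### Second moments of observer errors and residuals for arbitrary gains. -/

section ObserverError

open Matrix

variable {Ω ι κ ι' : Type*} [Fintype ι] [Fintype κ] [Fintype ι'] [MeasurableSpace Ω]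
  {μ : Measure Ω}

/-- An initial error `e` with covariance `P` and two white noises `w`, `u` with covariances `Q`,
`R`, all mutually uncorrelated. -/
structure IsUncorrelatedDrive (μ : Measure Ω) (Q : Matrix ι ι ℝ) (R : Matrix κ κ ℝ)
    (P : Matrix ι ι ℝ) (e : Ω → ι → ℝ) (w : ℕ → Ω → ι → ℝ) (u : ℕ → Ω → κ → ℝ) : Prop where
  noise_w : IsWhiteNoise μ Q w
  noise_u : IsWhiteNoise μ R u
  uncorr : ∀ k l, crossMoment μ (w k) (u l) = 0
  init_centered : IsCenteredL2 μ e
  init_cov : crossMoment μ e e = P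
  init_w : ∀ k, crossMoment μ e (w k) = 0
  init_u : ∀ k, crossMoment μ e (u k) = 0

/-- The error of the linear observer with gains `K 0, K 1, …`. -/
def observerError (A : Matrix ι ι ℝ) (C : Matrix κ ι ℝ) (e : Ω → ι → ℝ) (w : ℕ → Ω → ι → ℝ)
    (u : ℕ → Ω → κ → ℝ) (K : ℕ → Matrix ι κ ℝ) : ℕ → Ω → ι → ℝ
  | 0 => e
  | t + 1 => fun ω =>
      (A - K t * C) *ᵥ observerError A C e w u K t ω + w t ω - K t *ᵥ u t ω

namespace IsUncorrelatedDrive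

variable {A : Matrix ι ι ℝ} {C : Matrix κ ι ℝ} {Q P : Matrix ι ι ℝ} {R : Matrix κ κ ℝ}
  {e : Ω → ι → ℝ} {w : ℕ → Ω → ι → ℝ} {u : ℕ → Ω → κ → ℝ} [IsFiniteMeasure μ]

theorem error_centered (h : IsUncorrelatedDrive μ Q R P e w u) (K : ℕ → Matrix ι κ ℝ) (t : ℕ) :
    IsCenteredL2 μ (observerError A C e w u K t) := by
  induction t with
  | zero => exact h.init_centered
  | succ t ih =>
    exact ((ih.mulVec _).add (h.noise_w.centered t)).sub ((h.noise_u.centered t).mulVec _)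

theorem crossMoment_error_succ_left (h : IsUncorrelatedDrive μ Q R P e w u)
    (K : ℕ → Matrix ι κ ℝ) (t : ℕ) {Z : Ω → ι' → ℝ} (hZ : ∀ i, MemLp (fun ω => Z ω i) 2 μ) :
    crossMoment μ (observerError A C e w u K (t + 1)) Z =
      (A - K t * C) * crossMoment μ (observerError A C e w u K t) Z
        + crossMoment μ (w t) Z - K t * crossMoment μ (u t) Z := by
  have he := (h.error_centered (A := A) (C := C) K t).memLp
  have hw := (h.noise_w.centered t).memLp
  have hu := (h.noise_u.centered t).memLp
  rw [observerError, crossMoment_sub_left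
      (((h.error_centered K t).mulVec _).add (h.noise_w.centered t)).memLp
      (memLp_mulVec _ hu) hZ,
    crossMoment_add_left (memLp_mulVec _ he) hw hZ, crossMoment_mulVec_left he hZ,
    crossMoment_mulVec_left hu hZ]

theorem crossMoment_error_succ_right (h : IsUncorrelatedDrive μ Q R P e w u)
    (K : ℕ → Matrix ι κ ℝ) (t : ℕ) {Z : Ω → ι' → ℝ} (hZ : ∀ i, MemLp (fun ω => Z ω i) 2 μ) :
    crossMoment μ Z (observerError A C e w u K (t + 1)) =
      crossMoment μ Z (observerError A C e w u K t) * (A - K t * C)ᵀ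
        + crossMoment μ Z (w t) - crossMoment μ Z (u t) * (K t)ᵀ := by
  rw [← crossMoment_transpose, h.crossMoment_error_succ_left K t hZ]
  simp only [transpose_sub, transpose_add, transpose_mul, crossMoment_transpose]

theorem crossMoment_error_w (h : IsUncorrelatedDrive μ Q R P e w u) (K : ℕ → Matrix ι κ ℝ)
    {t j : ℕ} (htj : t ≤ j) : crossMoment μ (observerError A C e w u K t) (w j) = 0 := by
  induction t with
  | zero => exact h.init_w j
  | succ t ih =>
    rw [h.crossMoment_error_succ_left K t (h.noise_w.centered j).memLp, ih (by omega),
      h.noise_w.cov, if_neg (by omega), crossMoment_eq_zero_comm (h.uncorr j t)]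
    simp

theorem crossMoment_error_u (h : IsUncorrelatedDrive μ Q R P e w u) (K : ℕ → Matrix ι κ ℝ)
    {t j : ℕ} (htj : t ≤ j) : crossMoment μ (observerError A C e w u K t) (u j) = 0 := by
  induction t with
  | zero => exact h.init_u j
  | succ t ih =>
    rw [h.crossMoment_error_succ_left K t (h.noise_u.centered j).memLp, ih (by omega),
      h.noise_u.cov, if_neg (by omega), h.uncorr]
    simp

/-- The joint covariance of the errors of two observers driven by the same noises. -/
theorem crossMoment_error_error (h : IsUncorrelatedDrive μ Q R P e w u)
    {K K' : ℕ → Matrix ι κ ℝ} {G : ℕ → Matrix ι ι ℝ} (h0 : G 0 = P)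
    (hstep : ∀ t, G (t + 1) =
      (A - K t * C) * G t * (A - K' t * C)ᵀ + Q + K t * R * (K' t)ᵀ) (t : ℕ) :
    crossMoment μ (observerError A C e w u K t) (observerError A C e w u K' t) = G t := by
  induction t with
  | zero => rw [h0]; exact h.init_cov
  | succ t ih =>
    have he := (h.error_centered (A := A) (C := C) K t).memLp
    have hw := (h.noise_w.centered t).memLp
    have hu := (h.noise_u.centered t).memLp
    rw [h.crossMoment_error_succ_left K t (h.error_centered K' (t + 1)).memLp,
      h.crossMoment_error_succ_right K' t he, h.crossMoment_error_succ_right K' t hw,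
      h.crossMoment_error_succ_right K' t hu, ih, h.crossMoment_error_w K le_rfl,
      h.crossMoment_error_u K le_rfl,
      crossMoment_eq_zero_comm (h.crossMoment_error_w K' le_rfl),
      crossMoment_eq_zero_comm (h.crossMoment_error_u K' le_rfl), h.noise_w.cov, h.noise_u.cov,
      h.uncorr, crossMoment_eq_zero_comm (h.uncorr t t), hstep, if_pos rfl, if_pos rfl]
    simp [Matrix.mul_assoc]

/-- The output residual `C e_t + u_t` of an observer. -/
theorem residual_centered (h : IsUncorrelatedDrive μ Q R P e w u) (K : ℕ → Matrix ι κ ℝ) (t : ℕ) :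
    IsCenteredL2 μ fun ω => C *ᵥ observerError A C e w u K t ω + u t ω :=
  ((h.error_centered K t).mulVec C).add (h.noise_u.centered t)

/-- If `K` satisfies the orthogonality condition against `H`, the error of `K` is uncorrelated
with the past `H`-components of the residuals of `K'`. -/
theorem crossMoment_error_residual (h : IsUncorrelatedDrive μ Q R P e w u)
    {K K' : ℕ → Matrix ι κ ℝ} {G : ℕ → Matrix ι ι ℝ}
    (hcov : ∀ t,
      crossMoment μ (observerError A C e w u K t) (observerError A C e w u K' t) = G t)
    (H : Matrix ι' κ ℝ) (horth : ∀ t, (A - K t * C) * G t * Cᵀ * Hᵀ = K t * R * Hᵀ)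
    {j t : ℕ} (hjt : j < t) :
    crossMoment μ (observerError A C e w u K t)
      (fun ω => H *ᵥ (C *ᵥ observerError A C e w u K' j ω + u j ω)) = 0 := by
  have hZ := ((h.residual_centered (A := A) (C := C) K' j).mulVec H).memLp
  have he' := (h.error_centered (A := A) (C := C) K' j).memLp
  have hu := (h.noise_u.centered j).memLp
  have expand : ∀ {ι'' : Type _} [Fintype ι''] {Y : Ω → ι'' → ℝ}
      (_ : ∀ i, MemLp (fun ω => Y ω i) 2 μ),
      crossMoment μ Y (fun ω => H *ᵥ (C *ᵥ observerError A C e w u K' j ω + u j ω)) =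
        (crossMoment μ Y (observerError A C e w u K' j) * Cᵀ + crossMoment μ Y (u j)) * Hᵀ := by
    intro ι'' _ Y hY
    rw [crossMoment_mulVec_right hY (h.residual_centered K' j).memLp,
      crossMoment_add_right hY (memLp_mulVec C he') hu, crossMoment_mulVec_right hY he']
  induction t, hjt using Nat.le_induction with
  | base =>
    have hw := (h.noise_w.centered j).memLp
    rw [h.crossMoment_error_succ_left K j hZ, expand (h.error_centered K j).memLp, expand hw,
      crossMoment_mulVec_right hu (h.residual_centered K' j).memLp,
      crossMoment_add_right hu (memLp_mulVec C he') hu, crossMoment_mulVec_right hu he',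
      hcov, h.crossMoment_error_u K le_rfl, h.uncorr,
      crossMoment_eq_zero_comm (h.crossMoment_error_w K' le_rfl),
      crossMoment_eq_zero_comm (h.crossMoment_error_u K' le_rfl), h.noise_u.cov, if_pos rfl]
    -- The noise u_j enters both the error at time j + 1 and the residual at time j; orthogonality
    -- cancels its contribution against that of the errors. Later steps bring in only noise
    -- uncorrelated with this residual.
    have := horth j
    simp only [Matrix.mul_assoc] at this
    simp [Matrix.mul_assoc, this]
  | succ t hjt ih =>
    have hjt' : j < t := hjt
    have hw := (h.noise_w.centered t).memLp
    have hut := (h.noise_u.centered t).memLp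
    rw [h.crossMoment_error_succ_left K t hZ, ih, expand hw,
      crossMoment_mulVec_right hut (h.residual_centered K' j).memLp,
      crossMoment_add_right hut (memLp_mulVec C he') hu, crossMoment_mulVec_right hut he',
      h.uncorr, crossMoment_eq_zero_comm (h.crossMoment_error_w K' hjt'.le),
      crossMoment_eq_zero_comm (h.crossMoment_error_u K' hjt'.le), h.noise_u.cov,
      if_neg (by omega)]
    simp

/-- Past and present residuals, in the components where the orthogonality condition holds, are
uncorrelated. -/
theorem crossMoment_residual_of_lt (h : IsUncorrelatedDrive μ Q R P e w u)
    {K K' : ℕ → Matrix ι κ ℝ} {G : ℕ → Matrix ι ι ℝ}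
    (hcov : ∀ t,
      crossMoment μ (observerError A C e w u K t) (observerError A C e w u K' t) = G t)
    (H : Matrix ι' κ ℝ) (horth : ∀ t, (A - K t * C) * G t * Cᵀ * Hᵀ = K t * R * Hᵀ)
    {j t : ℕ} (hjt : j < t) :
    crossMoment μ (fun ω => H *ᵥ (C *ᵥ observerError A C e w u K t ω + u t ω))
      (fun ω => H *ᵥ (C *ᵥ observerError A C e w u K' j ω + u j ω)) = 0 := by
  have hZ := ((h.residual_centered (A := A) (C := C) K' j).mulVec H).memLp
  have he := (h.error_centered (A := A) (C := C) K t).memLp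
  have he' := (h.error_centered (A := A) (C := C) K' j).memLp
  have huj := (h.noise_u.centered j).memLp
  have hut := (h.noise_u.centered t).memLp
  rw [crossMoment_mulVec_left (h.residual_centered K t).memLp hZ,
    crossMoment_add_left (memLp_mulVec C he) hut hZ, crossMoment_mulVec_left he hZ,
    h.crossMoment_error_residual hcov H horth hjt,
    crossMoment_mulVec_right hut (h.residual_centered K' j).memLp,
    crossMoment_add_right hut (memLp_mulVec C he') huj, crossMoment_mulVec_right hut he',
    crossMoment_eq_zero_comm (h.crossMoment_error_u K' hjt.le), h.noise_u.cov,
    if_neg (by omega)]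
  simp

theorem crossMoment_residual_self (h : IsUncorrelatedDrive μ Q R P e w u)
    (K : ℕ → Matrix ι κ ℝ) (H : Matrix ι' κ ℝ) (t : ℕ) :
    crossMoment μ (fun ω => H *ᵥ (C *ᵥ observerError A C e w u K t ω + u t ω))
      (fun ω => H *ᵥ (C *ᵥ observerError A C e w u K t ω + u t ω)) =
      H * (C * crossMoment μ (observerError A C e w u K t) (observerError A C e w u K t) * Cᵀ
        + R) * Hᵀ := by
  have hr := (h.residual_centered (A := A) (C := C) K t).memLp
  have he := (h.error_centered (A := A) (C := C) K t).memLp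
  have hu := (h.noise_u.centered t).memLp
  have hCe := memLp_mulVec C he
  rw [crossMoment_mulVec_left hr (memLp_mulVec H hr), crossMoment_mulVec_right hr hr,
    crossMoment_add_left hCe hu hr, crossMoment_add_right hCe hCe hu,
    crossMoment_add_right hu hCe hu, crossMoment_mulVec_left he hCe,
    crossMoment_mulVec_left he hu, crossMoment_mulVec_right he he,
    crossMoment_mulVec_right hu he, h.crossMoment_error_u K le_rfl,
    crossMoment_eq_zero_comm (h.crossMoment_error_u K le_rfl), h.noise_u.cov, if_pos rfl]
  simp [Matrix.mul_assoc]

end IsUncorrelatedDrive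

end ObserverError
-- The delayed predictor as one observer on the stacked observations.
namespace TwoSourceModel

open scoped MatrixOrder
open Matrix

variable {n m m' : ℕ} {S : TwoSourceModel n m m'} {Pbar : Matrix (Fin n) (Fin n) ℝ}

/-- The selection of the local observations from the centralized ones. -/
def localSelect (m m' : ℕ) : Matrix (Fin m) (Fin m ⊕ Fin m') ℝ :=
  fromCols 1 0

theorem localGain_eq_mul_localSelect (K : Matrix (Fin n) (Fin m) ℝ) :
    localGain m' K = K * localSelect m m' := by
  rw [localGain, localSelect, mul_fromCols, Matrix.mul_one, Matrix.mul_zero]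

theorem localSelect_mul_Cbar : localSelect m m' * S.Cbar = S.C := by
  rw [localSelect, Cbar, fromCols_mul_fromRows, Matrix.zero_mul, add_zero, Matrix.one_mul]

theorem Cbar_transpose_mul_localSelect : S.Cbarᵀ * (localSelect m m')ᵀ = S.Cᵀ := by
  rw [← transpose_mul, localSelect_mul_Cbar]

theorem localSelect_mulVec_elim (a : Fin m → ℝ) (b : Fin m' → ℝ) :
    localSelect m m' *ᵥ Sum.elim a b = a := by
  simp [localSelect]

theorem localSelect_mul_Rbar_mul : localSelect m m' * S.Rbar * (localSelect m m')ᵀ = S.R := by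
  rw [localSelect, Rbar, fromCols_mul_fromBlocks, transpose_fromCols, fromCols_mul_fromRows]
  simp

/-- The gains of the centralized filter up to time `s`, followed by the local Kalman gains. -/
noncomputable def delayedGain (S : TwoSourceModel n m m') (Pbar : Matrix (Fin n) (Fin n) ℝ) (s t : ℕ) :
    Matrix (Fin n) (Fin m ⊕ Fin m') ℝ :=
  if t < s then S.Lbar Pbar else localGain m' (S.gain Pbar (t - s))

theorem delayedGain_of_lt {s t : ℕ} (h : t < s) : S.delayedGain Pbar s t = S.Lbar Pbar :=
  if_pos h

theorem delayedGain_of_le {s t : ℕ} (h : s ≤ t) :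
    S.delayedGain Pbar s t = localGain m' (S.gain Pbar (t - s)) :=
  if_neg (by omega)

variable (hQ : S.Q.PosDef) (hR : S.R.PosDef) (hRe : S.Re.PosDef)
  (h : IsRiccatiSolution S.A S.Cbar S.Q S.Rbar Pbar)

-- Before the switch the centralized gain is orthogonal in all components; afterwards the padded
-- local gain is so only in the local ones. The truncated subtraction t - s makes the covariance P̄
-- throughout t ≤ s.
include hQ hR hRe h in
theorem delayedGain_orthogonality_localSelect (s t : ℕ) :
    (S.A - S.delayedGain Pbar s t * S.Cbar) * S.cov Pbar (t - s) * S.Cbarᵀ * (localSelect m m')ᵀ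
      = S.delayedGain Pbar s t * S.Rbar * (localSelect m m')ᵀ := by
  rcases lt_or_ge t s with hts | hts
  · rw [delayedGain_of_lt hts, Nat.sub_eq_zero_of_le hts.le, cov_zero, Lbar,
      kalmanGain_orthogonality (Rbar_posDef hR hRe) h.nonneg]
  · rw [delayedGain_of_le hts, localGain_mul_Cbar, Matrix.mul_assoc,
      Cbar_transpose_mul_localSelect, localGain_eq_mul_localSelect, Matrix.mul_assoc _ _ S.Rbar,
      Matrix.mul_assoc _ (_ * S.Rbar), localSelect_mul_Rbar_mul]
    exact kalmanGain_orthogonality hR (cov_nonneg hQ hR h.nonneg _)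

include hQ hR hRe h in
/-- A filter that loses the external source earlier has gains in the span where the orthogonality
condition of the later one holds. -/
theorem delayedGain_orthogonality {s' s : ℕ} (hs : s' ≤ s) (t : ℕ) :
    (S.A - S.delayedGain Pbar s t * S.Cbar) * S.cov Pbar (t - s) * S.Cbarᵀ *
        (S.delayedGain Pbar s' t)ᵀ
      = S.delayedGain Pbar s t * S.Rbar * (S.delayedGain Pbar s' t)ᵀ := by
  rcases lt_or_ge t s with hts | hts
  · rw [delayedGain_of_lt hts, Nat.sub_eq_zero_of_le hts.le, cov_zero, Lbar,
      kalmanGain_orthogonality (Rbar_posDef hR hRe) h.nonneg]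
  · rw [delayedGain_of_le (hs.trans hts), localGain_eq_mul_localSelect, transpose_mul,
      ← Matrix.mul_assoc, ← Matrix.mul_assoc,
      delayedGain_orthogonality_localSelect hQ hR hRe h]

include h in
theorem cov_succ_sub (s t : ℕ) : S.cov Pbar (t + 1 - s) =
    (S.A - S.delayedGain Pbar s t * S.Cbar) * S.cov Pbar (t - s) * S.Aᵀ + S.Q := by
  rcases lt_or_ge t s with hts | hts
  · rw [delayedGain_of_lt hts, Nat.sub_eq_zero_of_le hts.le,
      Nat.sub_eq_zero_of_le (Nat.succ_le_of_lt hts), cov_zero, Lbar]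
    conv_lhs => rw [h.2, riccati_eq_sub]
    simp only [Matrix.sub_mul, Matrix.mul_assoc]
    abel
  · rw [delayedGain_of_le hts, localGain_mul_Cbar, Nat.sub_add_comm hts, cov_succ,
      riccati_eq_sub, gain]
    simp only [Matrix.sub_mul, Matrix.mul_assoc]
    abel

-- Replacing `S.Aᵀ` in the one-sided Riccati recursion by the transposed closed loop of the other
-- observer changes it by a term that orthogonality cancels against the observation noise term.
include hQ hR hRe h in
theorem cov_succ_sub_eq_joint {s' s : ℕ} (hs : s' ≤ s) (t : ℕ) : S.cov Pbar (t + 1 - s) =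
    (S.A - S.delayedGain Pbar s t * S.Cbar) * S.cov Pbar (t - s) *
        (S.A - S.delayedGain Pbar s' t * S.Cbar)ᵀ + S.Q +
      S.delayedGain Pbar s t * S.Rbar * (S.delayedGain Pbar s' t)ᵀ := by
  rw [cov_succ_sub h, ← delayedGain_orthogonality hQ hR hRe h hs, transpose_sub,
    transpose_mul, Matrix.mul_sub, ← Matrix.mul_assoc _ S.Cbarᵀ]
  abel

end TwoSourceModel

/-! ### Innovations of a steady run and the autoregressive model. -/

namespace SteadyRun

open Matrix TwoSourceModel

variable {n m m' : ℕ} {S : TwoSourceModel n m m'} {Pbar : Matrix (Fin n) (Fin n) ℝ}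
  {Ω : Type*} [MeasurableSpace Ω] {μ : Measure Ω} (T : SteadyRun S Pbar μ)

/-- The initial prediction error. -/
def initError (ω : Ω) : Fin n → ℝ := T.x 0 ω - T.xbar 0 ω

/-- The stacked observation noise. -/
def vbar (k : ℕ) (ω : Ω) : Fin m ⊕ Fin m' → ℝ := Sum.elim (T.v k ω) (T.ve k ω)

theorem isUncorrelatedDrive :
    IsUncorrelatedDrive μ S.Q S.Rbar Pbar T.initError T.w T.vbar where
  noise_w := T.noise_w
  noise_u :=
    { centered := fun k =>
        ⟨fun i => by
          rcases i with i | i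
          · exact (T.noise_v.centered k).memLp i
          · exact (T.noise_ve.centered k).memLp i,
        fun i => by
          rcases i with i | i
          · exact (T.noise_v.centered k).mean i
          · exact (T.noise_ve.centered k).mean i⟩
      cov := fun k l => by
        have h1 := T.noise_v.cov k l
        have h2 := T.noise_ve.cov k l
        have h3 := T.uncorr_v_ve k l
        have h4 := crossMoment_eq_zero_comm (T.uncorr_v_ve l k)
        ext (i | i) (j | j)
        · refine (congrFun (congrFun h1 i) j).trans ?_
          split_ifs <;> rfl
        · refine (congrFun (congrFun h3 i) j).trans ?_
          split_ifs <;> rfl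
        · refine (congrFun (congrFun h4 i) j).trans ?_
          split_ifs <;> rfl
        · refine (congrFun (congrFun h2 i) j).trans ?_
          split_ifs <;> rfl }
  uncorr := fun k l => by
    ext i (j | j)
    · exact congrFun (congrFun (T.uncorr_w_v k l) i) j
    · exact congrFun (congrFun (T.uncorr_w_ve k l) i) j
  init_centered := T.init_centered
  init_cov := T.init_cov
  init_w := T.init_w
  init_u := fun k => by
    ext i (j | j)
    · exact congrFun (congrFun (T.init_v k) i) j
    · exact congrFun (congrFun (T.init_ve k) i) j

/-- The error at time `t` of the predictor that has the external observations up to time `s`. -/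
noncomputable def error (s t : ℕ) (ω : Ω) : Fin n → ℝ :=
  observerError S.A S.Cbar T.initError T.w T.vbar (S.delayedGain Pbar s) t ω

theorem error_succ (s t : ℕ) (ω : Ω) : T.error s (t + 1) ω =
    (S.A - S.delayedGain Pbar s t * S.Cbar) *ᵥ T.error s t ω + T.w t ω
      - S.delayedGain Pbar s t *ᵥ T.vbar t ω := rfl

theorem yc_eq (k : ℕ) (ω : Ω) : T.yc k ω = S.Cbar *ᵥ T.x k ω + T.vbar k ω := by
  ext (i | i)
  · simp [yc, y, vbar, Cbar]
  · simp [yc, ye, vbar, Cbar]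

theorem xbar_succ (k : ℕ) (ω : Ω) : T.xbar (k + 1) ω =
    (S.A - S.Lbar Pbar * S.Cbar) *ᵥ T.xbar k ω + S.Lbar Pbar *ᵥ T.yc k ω := by
  rw [T.filter_eq k ω]
  change _ + S.Lbar Pbar *ᵥ (T.yc k ω - _) = _
  rw [mulVec_sub, sub_mulVec, mulVec_mulVec]
  abel

theorem x_sub_xbar {s t : ℕ} (hts : t ≤ s) (ω : Ω) :
    T.x t ω - T.xbar t ω = T.error s t ω := by
  induction t with
  | zero => rfl
  | succ t ih =>
    rw [T.error_succ, ← ih (by omega), delayedGain_of_lt (by omega), T.xbar_succ, T.yc_eq,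
      T.state_eq]
    simp only [mulVec_sub, mulVec_add, sub_mulVec, mulVec_mulVec]
    abel

/-- The local predictor at time `s + i`, started from the centralized one at time `s`. -/
noncomputable def localPredictor (s i : ℕ) (ω : Ω) : Fin n → ℝ :=
  S.Phi Pbar i *ᵥ T.xbar s ω +
    ∑ j ∈ Finset.range i,
      (S.transition Pbar (j + 1) (i - (j + 1)) * S.gain Pbar j) *ᵥ T.y (s + j) ω

theorem localPredictor_succ (s i : ℕ) (ω : Ω) : T.localPredictor s (i + 1) ω =
    (S.A - S.gain Pbar i * S.C) *ᵥ T.localPredictor s i ω + S.gain Pbar i *ᵥ T.y (s + i) ω := by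
  rw [localPredictor, localPredictor, Finset.sum_range_succ, mulVec_add, mulVec_mulVec,
    mulVec_sum, Phi_succ, ← add_assoc]
  congr 2
  · refine Finset.sum_congr rfl fun j hj => ?_
    have hj := Finset.mem_range.1 hj
    rw [mulVec_mulVec, ← Matrix.mul_assoc, show i + 1 - (j + 1) = (i - (j + 1)) + 1 by omega,
      transition, show j + 1 + (i - (j + 1)) = i by omega]
  -- The newest summand carries an empty product of closed-loop factors.
  · simp [transition]

theorem x_sub_localPredictor (s i : ℕ) (ω : Ω) :
    T.x (s + i) ω - T.localPredictor s i ω = T.error s (s + i) ω := by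
  induction i with
  | zero => simpa [localPredictor, Phi, transition] using T.x_sub_xbar (le_refl s) ω
  | succ i ih =>
    rw [← add_assoc, T.error_succ, ← ih, delayedGain_of_le (by omega), T.localPredictor_succ,
      T.state_eq, localGain_mul_Cbar, localGain_eq_mul_localSelect, ← mulVec_mulVec, vbar,
      localSelect_mulVec_elim, show s + i - s = i by omega, y]
    simp only [mulVec_sub, mulVec_add, sub_mulVec, mulVec_mulVec]
    abel

/-- The switching time k - d moves with k, so innovations at different times come from different
observers driven by the same noises. -/
theorem innovation_eq {d k : ℕ} (hk : d ≤ k) : T.innovation d k = fun ω =>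
    localSelect m m' *ᵥ (S.Cbar *ᵥ observerError S.A S.Cbar T.initError T.w T.vbar
      (S.delayedGain Pbar (k - d)) k ω + T.vbar k ω) := by
  funext ω
  have h1 := T.x_sub_localPredictor (k - d) d ω
  rw [Nat.sub_add_cancel hk, error] at h1
  rw [← h1, mulVec_add, mulVec_mulVec, localSelect_mul_Cbar, vbar, localSelect_mulVec_elim,
    innovation, y, mulVec_sub]
  change _ - S.C *ᵥ T.localPredictor (k - d) d ω = _
  abel

theorem innovation_centered [IsFiniteMeasure μ] {d k : ℕ} (hk : d ≤ k) :
    IsCenteredL2 μ (T.innovation d k) := by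
  rw [T.innovation_eq hk]
  exact (T.isUncorrelatedDrive.residual_centered _ k).mulVec _

section Orthogonality

variable [IsFiniteMeasure μ] (hQ : S.Q.PosDef) (hR : S.R.PosDef) (hRe : S.Re.PosDef)
  (h : IsRiccatiSolution S.A S.Cbar S.Q S.Rbar Pbar)

include hQ hR hRe h

theorem crossMoment_error {s' s : ℕ} (hs : s' ≤ s) (t : ℕ) :
    crossMoment μ
      (observerError S.A S.Cbar T.initError T.w T.vbar (S.delayedGain Pbar s) t)
      (observerError S.A S.Cbar T.initError T.w T.vbar (S.delayedGain Pbar s') t)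
      = S.cov Pbar (t - s) :=
  T.isUncorrelatedDrive.crossMoment_error_error (G := fun t => S.cov Pbar (t - s))
    (by simp [cov_zero]) (cov_succ_sub_eq_joint hQ hR hRe h hs) t

theorem crossMoment_innovation_of_lt {d k l : ℕ} (hk : d ≤ k) (hkl : k < l) :
    crossMoment μ (T.innovation d l) (T.innovation d k) = 0 := by
  rw [T.innovation_eq hk, T.innovation_eq (hk.trans hkl.le)]
  exact T.isUncorrelatedDrive.crossMoment_residual_of_lt
    -- The later innovation belongs to the later-switching observer, k - d ≤ l - d, as the joint
    -- covariance formula requires.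
    (T.crossMoment_error hQ hR hRe h (by omega)) _
    (delayedGain_orthogonality_localSelect hQ hR hRe h _) hkl

theorem crossMoment_innovation_self {d k : ℕ} (hk : d ≤ k) :
    crossMoment μ (T.innovation d k) (T.innovation d k) = S.innovationCov Pbar d := by
  rw [T.innovation_eq hk, T.isUncorrelatedDrive.crossMoment_residual_self,
    T.crossMoment_error hQ hR hRe h le_rfl, Nat.sub_sub_self hk, innovationCov, Matrix.mul_add,
    Matrix.add_mul, localSelect_mul_Rbar_mul]
  congr 1
  rw [Matrix.mul_assoc, Matrix.mul_assoc _ S.Cbarᵀ, Cbar_transpose_mul_localSelect,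
    ← Matrix.mul_assoc, ← Matrix.mul_assoc, localSelect_mul_Cbar]

theorem crossMoment_innovation {d k l : ℕ} (hk : d ≤ k) (hl : d ≤ l) :
    crossMoment μ (T.innovation d k) (T.innovation d l) =
      if k = l then S.innovationCov Pbar d else 0 := by
  rcases lt_trichotomy k l with hkl | rfl | hkl
  · rw [if_neg hkl.ne]
    exact crossMoment_eq_zero_comm (T.crossMoment_innovation_of_lt hQ hR hRe h hk hkl)
  · rw [if_pos rfl, T.crossMoment_innovation_self hQ hR hRe h hk]
  · rw [if_neg hkl.ne']
    exact T.crossMoment_innovation_of_lt hQ hR hRe h hl hkl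

end Orthogonality

/-- Variation of constants for the centralized filter, run backwards; substituted at q = k - d it
turns the predictor into an autoregression of order p. -/
theorem xbar_unroll {p q : ℕ} (hpq : p ≤ q) (ω : Ω) : T.xbar q ω =
    ∑ j ∈ Finset.range p,
        ((S.A - S.Lbar Pbar * S.Cbar) ^ j * S.Lbar Pbar) *ᵥ T.yc (q - 1 - j) ω
      + (S.A - S.Lbar Pbar * S.Cbar) ^ p *ᵥ T.xbar (q - p) ω := by
  induction p with
  | zero => simp
  | succ p ih =>
    rw [ih (by omega), Finset.sum_range_succ, show q - p = (q - (p + 1)) + 1 by omega,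
      T.xbar_succ, mulVec_add, mulVec_mulVec, mulVec_mulVec, ← pow_succ,
      show q - 1 - p = q - (p + 1) by omega]
    abel

theorem autoregressive_model {d p k : ℕ} (hk : d + p ≤ k) (ω : Ω) : T.y k ω =
    ∑ i ∈ Finset.range d,
      (S.C * S.transition Pbar (i + 1) (d - (i + 1)) * S.gain Pbar i) *ᵥ T.y (k - d + i) ω
    + ∑ j ∈ Finset.range p,
      (S.C * S.Phi Pbar d * (S.A - S.Lbar Pbar * S.Cbar) ^ j * S.Lbar Pbar) *ᵥ
        T.yc (k - d - 1 - j) ω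
    + (S.C * S.Phi Pbar d * (S.A - S.Lbar Pbar * S.Cbar) ^ p) *ᵥ T.xbar (k - d - p) ω
    + T.innovation d k ω := by
  rw [innovation, xhat, T.xbar_unroll (p := p) (q := k - d) (by omega)]
  simp only [mulVec_add, mulVec_sum, mulVec_mulVec, Matrix.mul_assoc]
  abel

end SteadyRun

theorem theorem1 {n m m' : ℕ} (hn : 0 < n) (S : TwoSourceModel n m m')
    (hQ : S.Q.PosDef) (hR : S.R.PosDef) (hRe : S.Re.PosDef) (hdet : Detectable S.A S.C) :
    -- the steady-state covariances are well defined
    (∃! Pbar, IsRiccatiSolution S.A S.Cbar S.Q S.Rbar Pbar) ∧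
    (∃! P, IsRiccatiSolution S.A S.C S.Q S.R P) ∧
    ∀ Pbar P : Matrix (Fin n) (Fin n) ℝ,
      IsRiccatiSolution S.A S.Cbar S.Q S.Rbar Pbar → IsRiccatiSolution S.A S.C S.Q S.R P →
      -- the autoregressive model of every order `p`, and the orthogonality of its innovation
      (∀ (Ω : Type*) [MeasurableSpace Ω] (μ : Measure Ω) [IsProbabilityMeasure μ]
          (T : SteadyRun S Pbar μ) (d : ℕ),
        (∀ p k ω, d + p ≤ k →
          T.y k ω =
            ∑ i ∈ Finset.range d,
              (S.C * S.transition Pbar (i + 1) (d - (i + 1)) * S.gain Pbar i) *ᵥ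
                T.y (k - d + i) ω
            + ∑ j ∈ Finset.range p,
              (S.C * S.Phi Pbar d * (S.A - S.Lbar Pbar * S.Cbar) ^ j * S.Lbar Pbar) *ᵥ
                T.yc (k - d - 1 - j) ω
            + (S.C * S.Phi Pbar d * (S.A - S.Lbar Pbar * S.Cbar) ^ p) *ᵥ T.xbar (k - d - p) ω
            + T.innovation d k ω) ∧
        (∀ k, d ≤ k → IsCenteredL2 μ (T.innovation d k)) ∧
        (∀ k l, d ≤ k → d ≤ l →
          crossMoment μ (T.innovation d k) (T.innovation d l) =
            if k = l then S.innovationCov Pbar d else 0)) ∧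
      -- exponential convergence of the innovation covariance as the delay grows
      (S.innovationCov Pbar 0 = S.C * Pbar * S.Cᵀ + S.R ∧
        ∃ M γ : ℝ, 0 < γ ∧ γ < 1 ∧
          (∀ d, specNorm (S.innovationCov Pbar d - (S.C * P * S.Cᵀ + S.R)) ≤ M * γ ^ d) ∧
          (∀ (Ω : Type*) [MeasurableSpace Ω] (μ : Measure Ω) [IsProbabilityMeasure μ]
              (T : SteadyRun S Pbar μ) (d k : ℕ), d ≤ k →
            specNorm (crossMoment μ (T.innovation d k) (T.innovation d k)
              - (S.C * P * S.Cᵀ + S.R)) ≤ M * γ ^ d)) ∧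
      -- exponential stability of the state-transition matrix
      ((∀ d, ∃ τ ρ₀ : ℝ,
          τ = lamMax (S.cov Pbar d) / lamMin (S.cov Pbar 0) ∧
          ρ₀ = 1 - lamMin S.Q / lamMax (S.cov Pbar d) ∧
          0 ≤ ρ₀ ∧ ρ₀ < 1 ∧ (¬ (S.A = 0 ∧ ∃ q : ℝ, S.Q = q • 1) → 0 < ρ₀) ∧
          specNorm (S.Phi Pbar d) ^ 2 ≤ τ * ρ₀ ^ d) ∧
        (∃ M γ : ℝ, 0 < γ ∧ γ < 1 ∧ ∀ d, specNorm (S.Phi Pbar d) ^ 2 ≤ M * γ ^ d)) := by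
  have : Nonempty (Fin n) := ⟨⟨0, hn⟩⟩
  refine ⟨(TwoSourceModel.detectable_Cbar hdet).existsUnique_isRiccatiSolution hQ
    (TwoSourceModel.Rbar_posDef hR hRe), hdet.existsUnique_isRiccatiSolution hQ hR,
    fun Pbar P h hP => ⟨?_, ⟨rfl, ?_⟩, ?_, ?_⟩⟩
  · intro Ω _ μ _ T d
    exact ⟨fun p k ω hk => T.autoregressive_model hk ω, fun k hk => T.innovation_centered hk,
      fun k l hk hl => T.crossMoment_innovation hQ hR hRe h hk hl⟩
  · obtain ⟨M, γ, hγ, hγ1, hM⟩ := TwoSourceModel.innovationCov_converges hQ hR hRe h hP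
    refine ⟨M, γ, hγ, hγ1, hM, fun Ω _ μ _ T d k hk => ?_⟩
    -- The innovation covariance depends neither on k nor on the run, so the same constants apply.
    rw [T.crossMoment_innovation_self hQ hR hRe h hk]
    exact hM d
  · intro d
    have hcd := (TwoSourceModel.cov_posDef hQ hR hRe h d).isHermitian
    have hle := le_lamMax_smul_one hcd
    have hq := lamMin_pos hQ
    have hqb := TwoSourceModel.lamMin_Q_le hQ hR hRe h hle
    have hb := hq.trans_le hqb
    refine ⟨_, _, rfl, rfl, sub_nonneg.2 ((div_le_one hb).2 hqb), sub_lt_self _ (div_pos hq hb),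
      -- ρ₀ = 0 would mean that λ_min(Q) equals λ_max(P^(d+1)), the degenerate case.
      fun hne => sub_pos.2 ((div_lt_one hb).2 (hqb.lt_of_ne fun heq => hne ?_)),
      TwoSourceModel.specNorm_Phi_sq_le hQ hR hRe h hle⟩
    exact TwoSourceModel.eq_zero_of_lamMin_eq_lamMax hQ hR hRe h heq
  · exact TwoSourceModel.specNorm_Phi_sq_exponential hQ hR hRe h hP
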